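/- Let $N\ge 1$ and let $U$ be a Haar-distributed random unitary in $\mathsf U(2N)$, acting on $\mathbb C^2\otimes\mathbb C^N$ (one ancilla qubit, $M=2$). Let $A\in\mathbb C^{N\times N}$ be its upper-left $N\times N$ block (so that $U$ is a $1$-block-encoding of $A$), and let $\lambda_1,\dots,\lambda_N$ be the eigenvalues, with multiplicity and labeled in uniformly random order, of $A^\dagger A$. For $M\ge 2$ let $w(x)=(1-x)^{N(M-2)}$ and $(f,g)_w=\int_0^1 f(x)g(x)w(x)\,\mathrm dx$. For monic polynomials $C_0,\dots,C_{N-1}$ with $\deg C_i=i$ that are pairwise orthogonal with respect to $(\cdot,\cdot)_w$, let $$K(x,y)=w(x)\sum_{i=0}^{N-1}\frac{1}{c_i}C_i(x)C_i(y),\qquad c_i=(C_i,C_i)_w .$$ Then, for $M=2$: the weight is constant, $w\equiv 1$; polynomials $C_0,\dots,C_{N-1}$ as above exist, and for every such choice $$K(x,y)=\sum_{i=0}^{N-1}(2i+1)\,P_i(2x-1)\,P_i(2y-1)\qquad(x,y\in\mathbb R),$$ where $P_i$ is the $i$-th Legendre polynomial. Moreover, the joint eigenvalue distribution is determinantal with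 this kernel: for every $0\le\ell\le N$, the joint law of $(\lambda_1,\dots,\lambda_\ell)$ is supported in $[0,1]^\ell$ and has there, with respect to Lebesgue measure, the nonnegative density $$\mathbb P^{(\ell)}_{\mathrm{eig}}(x_1,\dots,x_\ell)=\frac{(N-\ell)!}{N!}\det\bigl[K(x_j,x_k)\bigr]_{j,k=1}^{\ell}.$$ -/

import Mathlib

open MeasureTheory Polynomial
open scoped ENNReal Nat

noncomputable section

namespace BlockEncoding

/-- The unitary group carries its Borel `σ`-algebra. -/
instance instMeasurableSpaceUnitaryGroup (ι : Type*) [Fintype ι] [DecidableEq ι] :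
    MeasurableSpace (Matrix.unitaryGroup ι ℂ) := borel _

instance instBorelSpaceUnitaryGroup (ι : Type*) [Fintype ι] [DecidableEq ι] :
    BorelSpace (Matrix.unitaryGroup ι ℂ) := ⟨rfl⟩

/-- The matrix `A` block encoded in the unitary `U` acting on `ℂ^M ⊗ ℂ^N` (ancilla register first):
its upper left `N × N` block, where the ancilla register is in the state `0`. -/
def block {M N : ℕ} [NeZero M] (U : Matrix.unitaryGroup (Fin M × Fin N) ℂ) :
    Matrix (Fin N) (Fin N) ℂ :=
  (U : Matrix (Fin M × Fin N) (Fin M × Fin N) ℂ).submatrix (fun i => (0, i)) (fun j => (0, j))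

/-- The eigenvalues (with multiplicity, in decreasing order up to a fixed relabeling of the
index set) of the Hermitian matrix `A† A`, with `A` the matrix block encoded in `U`. -/
def eigenvalues {M N : ℕ} [NeZero M] (U : Matrix.unitaryGroup (Fin M × Fin N) ℂ) : Fin N → ℝ :=
  (Matrix.isHermitian_conjTranspose_mul_self (block U)).eigenvalues

/-- The joint law of all eigenvalues of `A† A`, labeled in uniformly random order, when the
unitary is drawn from `μ`. -/
def eigenvalueLaw {M N : ℕ} [NeZero M] (μ : Measure (Matrix.unitaryGroup (Fin M × Fin N) ℂ)) :
    Measure (Fin N → ℝ) :=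
  (N ! : ℝ≥0∞)⁻¹ • ∑ π : Equiv.Perm (Fin N), μ.map (fun U i => eigenvalues U (π i))

/-- The joint law of `ℓ` eigenvalues: the marginal of `eigenvalueLaw` on the first `ℓ`
coordinates. -/
def eigenvalueMarginal {M N : ℕ} [NeZero M]
    (μ : Measure (Matrix.unitaryGroup (Fin M × Fin N) ℂ)) {ℓ : ℕ} (hℓ : ℓ ≤ N) :
    Measure (Fin ℓ → ℝ) :=
  (eigenvalueLaw μ).map (fun x i => x (Fin.castLE hℓ i))

/-- The weight function `w(x) = (1 - x)^{N (M - 2)}`. -/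
def weight (N M : ℕ) (x : ℝ) : ℝ := (1 - x) ^ ((N : ℤ) * ((M : ℤ) - 2))

/-- The weighted inner product `(f, g)_w = ∫₀¹ f g w` of two polynomials. -/
def weightedInner (w : ℝ → ℝ) (f g : ℝ[X]) : ℝ :=
  ∫ x in (0 : ℝ)..1, f.eval x * g.eval x * w x

/-- `C 0, …, C (N - 1)` are monic polynomials with `deg (C i) = i`, pairwise orthogonal with
respect to `(·, ·)_w`. -/
structure IsMonicOrthogonal (w : ℝ → ℝ) {N : ℕ} (C : Fin N → ℝ[X]) : Prop where
  monic : ∀ i, (C i).Monic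
  natDegree_eq : ∀ i, (C i).natDegree = i
  orthogonal : ∀ i j, i ≠ j → weightedInner w (C i) (C j) = 0

/-- The kernel `w(x) ∑ᵢ Cᵢ(x) Cᵢ(y) / cᵢ`, with `cᵢ = (Cᵢ, Cᵢ)_w`. -/
def kernel (w : ℝ → ℝ) {N : ℕ} (C : Fin N → ℝ[X]) (x y : ℝ) : ℝ :=
  w x * ∑ i, 1 / weightedInner w (C i) (C i) * (C i).eval x * (C i).eval y

/-- The `n`-th Legendre polynomial, by Rodrigues' formula. -/
def legendre (n : ℕ) : ℝ[X] :=
  Polynomial.C (1 / ((2 : ℝ) ^ n * (n ! : ℝ))) * derivative^[n] ((X ^ 2 - 1) ^ n)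

/-- `∑_{i < N} (2i + 1) Pᵢ(2x - 1) Pᵢ(2y - 1)`. -/
def legendreKernel (N : ℕ) (x y : ℝ) : ℝ :=
  ∑ i ∈ Finset.range N,
    (2 * (i : ℝ) + 1) * (legendre i).eval (2 * x - 1) * (legendre i).eval (2 * y - 1)

/-- The determinantal `ℓ`-point function `((N - ℓ)! / N!) det [K(λⱼ, λₖ)]`, for `ℓ ≤ N`. -/
def determinantalDensity (N : ℕ) (K : ℝ → ℝ → ℝ) {ℓ : ℕ} (x : Fin ℓ → ℝ) : ℝ :=
  (((N - ℓ)! : ℕ) : ℝ) / (N ! : ℝ) * (Matrix.of fun j k => K (x j) (x k)).det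

end BlockEncoding

end

/-!
Write `A` and `C` for the upper and lower left blocks of `U`, so that `C†C = 1 - A†A`, and `Δ²` for
the squared Vandermonde determinant of the eigenvalues `λ` of `A†A`. Instead of computing a
Jacobian, test Haar invariance on `f(λ) A (A†A)^k C†` with `f` symmetric: this gives the
Schwinger–Dyson (loop) equations for the functional `E : f ↦ 𝔼 f(λ)`. They say that `E` vanishes on
`Δ⁻² ∑ᵢ ∂ᵢ(λᵢ (1 - λᵢ) (∂ᵢ g) Δ²)` for every symmetric polynomial `g`, as integration against `Δ²`
over `[0,1]^N` does. If `h` represents `E` with respect to the inner product of `L²([0,1]^N, Δ²)` on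
symmetric polynomials of bounded degree, then taking `g = h` shows that
`∫ ∑ᵢ λᵢ (1 - λᵢ) (∂ᵢ h)² Δ² = 0`, so `h` is constant. Hence the moments of `λ` are those of the
density proportional to `Δ²`, and by Stone–Weierstrass the laws agree. Finally `Δ²` is, up to a
constant, the determinant of the Legendre kernel, and Gaudin's lemma for reproducing kernels
integrates out one variable at a time.
-/

noncomputable section

namespace BlockEncoding

open MvPolynomial (pderiv psum esymm symmetricSubalgebra)
open Finset.HasAntidiagonal (antidiagonal mem_antidiagonal)

section PowerSums

variable {σ R : Type*} [Fintype σ] [CommRing R]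

lemma esymm_mem_adjoin_psum [Algebra ℚ R] (k : ℕ) :
    esymm σ R k ∈ Algebra.adjoin R (Set.range fun j : ℕ => psum σ R (j + 1)) := by
  set A := Algebra.adjoin R (Set.range fun j : ℕ => psum σ R (j + 1))
  induction k using Nat.strong_induction_on with
  | _ k ih =>
    rcases k.eq_zero_or_pos with rfl | hk
    · simp
    have newton : (k : MvPolynomial σ R) * esymm σ R k ∈ A := by
      rw [MvPolynomial.mul_esymm_eq_sum]
      have neg_one_pow_mem (n : ℕ) : (-1 : MvPolynomial σ R) ^ n ∈ A :=
        pow_mem (neg_mem (one_mem A)) n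
      refine A.mul_mem (neg_one_pow_mem _) (sum_mem fun a ha => ?_)
      obtain ⟨hsum, hlt⟩ := Finset.mem_filter.1 ha
      rw [mem_antidiagonal] at hsum
      obtain ⟨j, hj⟩ : ∃ j, a.2 = j + 1 := ⟨a.2 - 1, by omega⟩
      rw [hj]
      exact A.mul_mem (A.mul_mem (neg_one_pow_mem _) (ih _ hlt))
        (Algebra.subset_adjoin ⟨j, rfl⟩)
    have hscale :
        esymm σ R k = algebraMap ℚ R (k : ℚ)⁻¹ • ((k : MvPolynomial σ R) * esymm σ R k) := by
      rw [← nsmul_eq_mul, ← Nat.cast_smul_eq_nsmul ℚ k, algebraMap_smul, smul_smul,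
        inv_mul_cancel₀ (by exact_mod_cast hk.ne'), one_smul]
    rw [hscale]
    exact A.smul_mem newton _

variable (σ R) in
theorem adjoin_psum_eq_symmetricSubalgebra [Algebra ℚ R] :
    Algebra.adjoin R (Set.range fun j : ℕ => psum σ R (j + 1)) = symmetricSubalgebra σ R := by
  refine le_antisymm (Algebra.adjoin_le ?_) fun f hf => ?_
  · rintro _ ⟨j, rfl⟩
    exact MvPolynomial.psum_isSymmetric σ R (j + 1)
  · obtain ⟨q, hq⟩ := MvPolynomial.esymmAlgHom_surjective R le_rfl ⟨f, hf⟩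
    have hfq : f = MvPolynomial.aeval (fun i : Fin (Fintype.card σ) => esymm σ R (i + 1)) q := by
      rw [← MvPolynomial.esymmAlgHom_apply, hq]
    have hmem : f ∈ Algebra.adjoin R
        (Set.range fun i : Fin (Fintype.card σ) => esymm σ R (i + 1)) := by
      rw [Algebra.adjoin_range_eq_range_aeval]
      exact ⟨q, hfq.symm⟩
    refine Algebra.adjoin_le ?_ hmem
    rintro _ ⟨i, rfl⟩
    exact esymm_mem_adjoin_psum _

lemma pderiv_psum_succ (i : σ) (k : ℕ) :
    pderiv i (psum σ R (k + 1)) = (k + 1 : MvPolynomial σ R) * MvPolynomial.X i ^ k := by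
  classical
  simp only [psum, map_sum, Derivation.leibniz_pow, MvPolynomial.pderiv_X, Pi.single_apply]
  simp

lemma isSymmetric_sum_X_pow_mul_pderiv {f : MvPolynomial σ R} (hf : f.IsSymmetric) (k : ℕ) :
    (∑ i, MvPolynomial.X i ^ k * pderiv i f).IsSymmetric := by
  intro e
  rw [map_sum, ← Equiv.sum_comp e fun i => MvPolynomial.X i ^ k * pderiv i f]
  refine Finset.sum_congr rfl fun i _ => ?_
  rw [map_mul, map_pow, MvPolynomial.rename_X, ← MvPolynomial.pderiv_rename e.injective, hf e]

end PowerSums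

lemma derivation_prod_of_apply_eq_mul {R A ι : Type*} [CommRing R] [CommRing A] [Algebra R A]
    (D : Derivation R A A) (s : Finset ι) (g c : ι → A) (h : ∀ i ∈ s, D (g i) = c i * g i) :
    D (∏ i ∈ s, g i) = (∑ i ∈ s, c i) * ∏ i ∈ s, g i := by
  classical
  induction s using Finset.induction_on with
  | empty => simp
  | insert a s ha ih =>
    rw [Finset.prod_insert ha, Finset.sum_insert ha, Derivation.leibniz,
      ih fun i hi => h i (Finset.mem_insert_of_mem hi), h a (Finset.mem_insert_self _ _)]
    simp only [smul_eq_mul]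
    ring

lemma sum_antidiagonal_pow_mul_pow_mul_sub {R : Type*} [CommRing R] (x y : R) (k : ℕ) :
    (∑ a ∈ antidiagonal k, x ^ a.1 * y ^ a.2) * (x - y) = x ^ (k + 1) - y ^ (k + 1) := by
  rw [Finset.Nat.sum_antidiagonal_eq_sum_range_succ fun i j => x ^ i * y ^ j]
  exact (Commute.all x y).geom_sum₂_mul (k + 1)

lemma two_mul_sum_sum_Ioi {ι R : Type*} [Fintype ι] [LinearOrder ι] [LocallyFiniteOrderTop ι]
    [LocallyFiniteOrderBot ι] [CommRing R] (c : ι → ι → R) (hc : ∀ i j, c i j = c j i) :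
    2 * ∑ i, ∑ j ∈ Finset.Ioi i, c j i = ∑ i, ∑ j, c j i - ∑ i, c i i := by
  have hoffdiag (i : ι) : ∑ j, c j i - c i i = ∑ j ∈ {i}ᶜ, c j i := by
    rw [sub_eq_iff_eq_add, ← Finset.sum_compl_add_sum {i}, Finset.sum_singleton]
  rw [← Finset.sum_sub_distrib, Finset.sum_congr rfl fun i _ => hoffdiag i,
    ← Finset.sum_sum_Ioi_add_eq_sum_sum_off_diag, Finset.mul_sum]
  refine Finset.sum_congr rfl fun i _ => ?_
  rw [Finset.mul_sum]
  exact Finset.sum_congr rfl fun j _ => by rw [hc i j, two_mul]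

section LoopOperator

variable {N : ℕ} {R : Type*} [CommRing R]

variable (N R) in
/-- The squared Vandermonde polynomial `Δ² = ∏_{i < j} (xⱼ - xᵢ)²`, the unnormalized density of
the Legendre ensemble. -/
def vandermondeSq : MvPolynomial (Fin N) R := (Matrix.vandermonde MvPolynomial.X).det ^ 2

lemma vandermondeSq_ne_zero [IsDomain R] : vandermondeSq N R ≠ 0 :=
  pow_ne_zero 2 (Matrix.det_vandermonde_ne_zero_iff.2 (MvPolynomial.X_injective))

lemma map_det_vandermonde {S : Type*} [CommRing S] (g : R →+* S) (x : Fin N → R) :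
    g (Matrix.vandermonde x).det = (Matrix.vandermonde fun i => g (x i)).det := by
  rw [RingHom.map_det]
  congr 1
  ext i j
  simp [Matrix.vandermonde_apply]

lemma eval_vandermondeSq (x : Fin N → R) :
    MvPolynomial.eval x (vandermondeSq N R) = (Matrix.vandermonde x).det ^ 2 := by
  rw [vandermondeSq, map_pow, map_det_vandermonde]
  simp only [MvPolynomial.eval_X]

lemma isSymmetric_vandermondeSq : (vandermondeSq N R).IsSymmetric := by
  intro π
  have hdet : (Matrix.vandermonde fun i => (MvPolynomial.X (π i) : MvPolynomial (Fin N) R)).det =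
      ((π.sign : ℤ) : MvPolynomial (Fin N) R) * (Matrix.vandermonde MvPolynomial.X).det :=
    Matrix.det_permute π (Matrix.vandermonde MvPolynomial.X)
  have hsign : ((π.sign : ℤ) : MvPolynomial (Fin N) R) ^ 2 = 1 := by
    rw [← Int.cast_pow, ← Units.val_pow_eq_pow_val, Int.units_sq]
    simp
  rw [vandermondeSq, map_pow, ← AlgHom.coe_toRingHom, map_det_vandermonde]
  simp only [RingHom.coe_coe, MvPolynomial.rename_X]
  rw [hdet, mul_pow, hsign, one_mul]

/-- The loop operator `L_k f = ∑ᵢ xᵢ^(k+1) ∂ᵢf + (∑_{a+b=k} p_a p_b) f`, with `p_a` the power sums: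
the divergence, relative to `Δ²`, of `f` times the vector field `∑ᵢ xᵢ^(k+1) ∂ᵢ`. -/
def loopOp (k : ℕ) (f : MvPolynomial (Fin N) R) : MvPolynomial (Fin N) R :=
  ∑ i, MvPolynomial.X i ^ (k + 1) * pderiv i f +
    (∑ a ∈ antidiagonal k, psum (Fin N) R a.1 * psum (Fin N) R a.2) * f

lemma isSymmetric_loopOp {f : MvPolynomial (Fin N) R} (hf : f.IsSymmetric) (k : ℕ) :
    (loopOp k f).IsSymmetric := by
  have hpsum : ∑ a ∈ antidiagonal k, psum (Fin N) R a.1 * psum (Fin N) R a.2 ∈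
      symmetricSubalgebra (Fin N) R :=
    sum_mem fun a _ => mul_mem (MvPolynomial.psum_isSymmetric _ R a.1)
      (MvPolynomial.psum_isSymmetric _ R a.2)
  exact (isSymmetric_sum_X_pow_mul_pderiv hf _).add (MvPolynomial.IsSymmetric.mul hpsum hf)

lemma mkDerivation_eq_sum_mul_pderiv {σ : Type*} [Fintype σ] (v : σ → MvPolynomial σ R)
    (f : MvPolynomial σ R) : MvPolynomial.mkDerivation R v f = ∑ i, v i * pderiv i f := by
  classical
  have happly (g : MvPolynomial σ R) :
      (∑ i, v i • pderiv i) g = ∑ i, v i * pderiv (R := R) i g := by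
    rw [← Derivation.coeFnAddMonoidHom_apply, map_sum, Finset.sum_apply]
    rfl
  rw [← happly]
  congr 1
  refine MvPolynomial.derivation_ext fun j => ?_
  rw [MvPolynomial.mkDerivation_X, happly]
  simp [MvPolynomial.pderiv_X, Pi.single_apply]

lemma sum_sum_antidiagonal_X_pow_mul_X_pow (k : ℕ) :
    ∑ i : Fin N, ∑ j, ∑ a ∈ antidiagonal k,
        (MvPolynomial.X j ^ a.1 * MvPolynomial.X i ^ a.2 : MvPolynomial (Fin N) R) =
      ∑ a ∈ antidiagonal k, psum (Fin N) R a.1 * psum (Fin N) R a.2 := by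
  simp only [psum, Finset.sum_mul_sum]
  rw [Finset.sum_comm, Finset.sum_comm (s := antidiagonal k)]
  exact Finset.sum_congr rfl fun i _ => Finset.sum_comm

lemma sum_X_pow_mul_pderiv_vandermondeSq (k : ℕ) :
    ∑ i, MvPolynomial.X i ^ (k + 1) * pderiv i (vandermondeSq N R) =
      (∑ a ∈ antidiagonal k, psum (Fin N) R a.1 * psum (Fin N) R a.2 -
        (k + 1 : MvPolynomial (Fin N) R) * psum (Fin N) R k) * vandermondeSq N R := by
  set D := MvPolynomial.mkDerivation R
    fun i : Fin N => (MvPolynomial.X i : MvPolynomial (Fin N) R) ^ (k + 1)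
  let c (i j : Fin N) : MvPolynomial (Fin N) R :=
    ∑ a ∈ antidiagonal k, MvPolynomial.X i ^ a.1 * MvPolynomial.X j ^ a.2
  have c_comm (i j : Fin N) : c i j = c j i := by
    simp only [c]
    rw [← Finset.Nat.sum_antidiagonal_swap]
    simp only [Prod.fst_swap, Prod.snd_swap, mul_comm]
  have c_self (i : Fin N) : c i i = (k + 1 : MvPolynomial (Fin N) R) * MvPolynomial.X i ^ k := by
    simp only [c, ← pow_add]
    rw [Finset.sum_congr rfl fun a ha => by rw [mem_antidiagonal.1 ha]]
    simp
  have hdet : D (Matrix.vandermonde MvPolynomial.X).det =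
      (∑ i, ∑ j ∈ Finset.Ioi i, c j i) * (Matrix.vandermonde MvPolynomial.X).det := by
    rw [Matrix.det_vandermonde]
    refine derivation_prod_of_apply_eq_mul D _ _ _ fun i _ =>
      derivation_prod_of_apply_eq_mul D _ _ _ fun j _ => ?_
    rw [map_sub, MvPolynomial.mkDerivation_X, MvPolynomial.mkDerivation_X,
      sum_antidiagonal_pow_mul_pow_mul_sub]
  have hpairs : 2 * ∑ i, ∑ j ∈ Finset.Ioi i, c j i =
      ∑ a ∈ antidiagonal k, psum (Fin N) R a.1 * psum (Fin N) R a.2 -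
        (k + 1 : MvPolynomial (Fin N) R) * psum (Fin N) R k := by
    rw [two_mul_sum_sum_Ioi c c_comm, sum_sum_antidiagonal_X_pow_mul_X_pow, psum, Finset.mul_sum]
    simp only [c_self]
  rw [← mkDerivation_eq_sum_mul_pderiv, vandermondeSq, Derivation.leibniz_pow, hdet, ← hpairs,
    nsmul_eq_mul, smul_eq_mul, pow_one]
  push_cast
  ring

theorem sum_pderiv_X_pow_mul_mul_vandermondeSq (k : ℕ) (f : MvPolynomial (Fin N) R) :
    ∑ i, pderiv i (MvPolynomial.X i ^ (k + 1) * f * vandermondeSq N R) =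
      loopOp k f * vandermondeSq N R := by
  have hleibniz (i : Fin N) : pderiv i (MvPolynomial.X i ^ (k + 1) * f * vandermondeSq N R) =
      (k + 1 : MvPolynomial (Fin N) R) * MvPolynomial.X i ^ k * (f * vandermondeSq N R) +
      MvPolynomial.X i ^ (k + 1) * pderiv i f * vandermondeSq N R +
      f * (MvPolynomial.X i ^ (k + 1) * pderiv i (vandermondeSq N R)) := by
    simp only [Derivation.leibniz, Derivation.leibniz_pow, MvPolynomial.pderiv_X_self, smul_eq_mul,
      nsmul_eq_mul, add_tsub_cancel_right]
    push_cast
    ring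
  simp only [hleibniz, Finset.sum_add_distrib]
  rw [← Finset.sum_mul, ← Finset.sum_mul, ← Finset.mul_sum, ← Finset.mul_sum,
    sum_X_pow_mul_pderiv_vandermondeSq, loopOp, psum]
  ring

end LoopOperator

section CubeIntegral

variable {σ : Type*} [Fintype σ]

variable (σ) in
/-- Integration of real polynomials over the unit cube `[0, 1]^σ`. -/
def cubeIntegral : MvPolynomial σ ℝ →ₗ[ℝ] ℝ where
  toFun f := ∫ x in Set.Icc (0 : σ → ℝ) 1, MvPolynomial.eval x f
  map_add' f g := by
    simp only [map_add]
    exact integral_add (MvPolynomial.continuous_eval f).integrableOn_Icc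
      (MvPolynomial.continuous_eval g).integrableOn_Icc
  map_smul' c f := by
    simp only [MvPolynomial.smul_eval, RingHom.id_apply, smul_eq_mul]
    exact integral_const_mul _ _

lemma cubeIntegral_apply (f : MvPolynomial σ ℝ) :
    cubeIntegral σ f = ∫ x in Set.Icc (0 : σ → ℝ) 1, MvPolynomial.eval x f := rfl

lemma volume_restrict_Icc_eq_pi : (volume : Measure (σ → ℝ)).restrict (Set.Icc 0 1) =
    Measure.pi fun _ => (volume : Measure ℝ).restrict (Set.Icc 0 1) := by
  rw [← Measure.restrict_pi_pi, ← volume_pi, ← Set.pi_univ_Icc]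
  rfl

lemma cubeIntegral_monomial (s : σ →₀ ℕ) (c : ℝ) :
    cubeIntegral σ (MvPolynomial.monomial s c) = c * ∏ i, ((s i : ℝ) + 1)⁻¹ := by
  have hpow (n : ℕ) : ∫ x in Set.Icc (0 : ℝ) 1, x ^ n = ((n : ℝ) + 1)⁻¹ := by
    rw [integral_Icc_eq_integral_Ioc, ← intervalIntegral.integral_of_le zero_le_one, integral_pow]
    simp
  simp only [cubeIntegral_apply, volume_restrict_Icc_eq_pi, MvPolynomial.eval_monomial,
    Finsupp.prod_fintype, pow_zero, implies_true, integral_const_mul,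
    integral_fintype_prod_eq_prod fun i (x : ℝ) => x ^ s i, hpow]

lemma cubeIntegral_pderiv_X_mul_monomial [DecidableEq σ] (i : σ) (s : σ →₀ ℕ) (c : ℝ) :
    cubeIntegral σ (pderiv i (MvPolynomial.X i * MvPolynomial.monomial s c)) =
      c * ∏ j ∈ Finset.univ.erase i, ((s j : ℝ) + 1)⁻¹ := by
  have hi : (s i : ℝ) + 1 ≠ 0 := by positivity
  rw [mul_comm, ← pow_one (MvPolynomial.X i), ← MvPolynomial.monomial_add_single,
    MvPolynomial.pderiv_monomial, add_tsub_cancel_right, cubeIntegral_monomial,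
    ← Finset.mul_prod_erase _ _ (Finset.mem_univ i)]
  simp only [Finsupp.add_apply, Finsupp.single_eq_same, Nat.cast_add, Nat.cast_one]
  field_simp

theorem cubeIntegral_pderiv_X_mul_one_sub_X_mul (i : σ) (f : MvPolynomial σ ℝ) :
    cubeIntegral σ (pderiv i (MvPolynomial.X i * (1 - MvPolynomial.X i) * f)) = 0 := by
  classical
  induction f using MvPolynomial.induction_on' with
  | add p q hp hq => rw [mul_add, map_add, map_add, hp, hq, add_zero]
  | monomial s c =>
    have hsplit : MvPolynomial.X i * (1 - MvPolynomial.X i) * MvPolynomial.monomial s c =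
        MvPolynomial.X i * MvPolynomial.monomial s c -
          MvPolynomial.X i * MvPolynomial.monomial (s + Finsupp.single i 1) c := by
      rw [MvPolynomial.monomial_add_single]
      ring
    rw [hsplit, map_sub, map_sub, cubeIntegral_pderiv_X_mul_monomial,
      cubeIntegral_pderiv_X_mul_monomial, sub_eq_zero]
    congr 1
    refine Finset.prod_congr rfl fun j hj => ?_
    simp [(Finset.ne_of_mem_erase hj).symm]

lemma cubeIntegral_nonneg {f : MvPolynomial σ ℝ}
    (hf : ∀ x ∈ Set.Icc (0 : σ → ℝ) 1, 0 ≤ MvPolynomial.eval x f) : 0 ≤ cubeIntegral σ f :=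
  setIntegral_nonneg measurableSet_Icc hf

lemma eq_zero_of_cubeIntegral_eq_zero {f : MvPolynomial σ ℝ}
    (hf : ∀ x ∈ Set.Icc (0 : σ → ℝ) 1, 0 ≤ MvPolynomial.eval x f) (h : cubeIntegral σ f = 0) :
    f = 0 := by
  have hae : (fun x => MvPolynomial.eval x f) =ᵐ[volume.restrict (Set.Icc 0 1)] 0 :=
    (setIntegral_eq_zero_iff_of_nonneg_ae ((ae_restrict_iff' measurableSet_Icc).2 (.of_forall hf))
      (MvPolynomial.continuous_eval f).integrableOn_Icc).1 h
  have hdense : Set.Icc (0 : σ → ℝ) 1 ⊆ closure (interior (Set.Icc 0 1)) := by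
    rw [← Set.pi_univ_Icc, interior_pi_set Set.finite_univ, closure_pi_set]
    simp [interior_Icc, closure_Ioo]
  have heq := Measure.eqOn_of_ae_eq hae (MvPolynomial.continuous_eval f).continuousOn
    continuousOn_const hdense
  refine MvPolynomial.funext_set (fun _ => Set.Icc (0 : ℝ) 1)
    (fun _ => Set.Icc_infinite zero_lt_one) fun x hx => ?_
  rw [map_zero]
  exact heq ⟨fun i => (hx i trivial).1, fun i => (hx i trivial).2⟩

end CubeIntegral

section Degree

variable {σ R : Type*} [CommRing R]

lemma totalDegree_pderiv_lt {i : σ} {p : MvPolynomial σ R} (h : pderiv i p ≠ 0) :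
    (pderiv i p).totalDegree < p.totalDegree := by
  obtain ⟨m, hm, hdeg⟩ := Finset.exists_mem_eq_sup _ (MvPolynomial.support_nonempty.2 h)
    fun s => s.sum fun _ e => e
  have hm' : m + Finsupp.single i 1 ∈ p.support := by
    rw [MvPolynomial.mem_support_iff, MvPolynomial.coeff_pderiv] at hm
    exact MvPolynomial.mem_support_iff.2 (left_ne_zero_of_mul hm)
  have hle := MvPolynomial.le_totalDegree hm'
  rw [Finsupp.sum_add_index' (fun _ => rfl) fun _ _ _ => rfl, Finsupp.sum_single_index rfl] at hle
  rw [MvPolynomial.totalDegree, hdeg]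
  exact hle

lemma eq_C_of_forall_pderiv_eq_zero [IsDomain R] [CharZero R] {p : MvPolynomial σ R}
    (h : ∀ i, pderiv i p = 0) : p = MvPolynomial.C (MvPolynomial.coeff 0 p) := by
  classical
  ext m
  rw [MvPolynomial.coeff_C]
  split_ifs with hm
  · rw [hm]
  obtain ⟨i, hi⟩ : ∃ i, m i ≠ 0 := by
    simpa [DFunLike.ext_iff, eq_comm] using hm
  have hcoeff := MvPolynomial.coeff_pderiv (i := i) p (m - Finsupp.single i 1)
  have hm_eq : m - Finsupp.single i 1 + Finsupp.single i 1 = m :=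
    tsub_add_cancel_of_le (Finsupp.single_le_iff.2 (Nat.one_le_iff_ne_zero.2 hi))
  rw [h i, MvPolynomial.coeff_zero, hm_eq] at hcoeff
  exact (mul_eq_zero.1 hcoeff.symm).resolve_right (Nat.cast_add_one_ne_zero _)

end Degree

lemma exists_forall_apply_eq_of_anisotropic {K V : Type*} [Field K] [AddCommGroup V] [Module K V]
    [FiniteDimensional K V] (B : V →ₗ[K] V →ₗ[K] K) (hB : ∀ v, B v v = 0 → v = 0)
    (E : V →ₗ[K] K) : ∃ h, ∀ f, E f = B h f := by
  have hinj : Function.Injective B :=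
    (injective_iff_map_eq_zero B).2 fun v hv => hB v (by rw [hv, LinearMap.zero_apply])
  obtain ⟨h, rfl⟩ := (LinearMap.injective_iff_surjective_of_finrank_eq_finrank
    (Subspace.dual_finrank_eq (K := K) (V := V)).symm).1 hinj E
  exact ⟨h, fun _ => rfl⟩

section LoopEquations

variable {N : ℕ}

/-- The linear functional `f ↦ ∫_{[0,1]^N} f Δ²`: the unnormalized expectation in the Legendre
ensemble. -/
def legendreFunctional (N : ℕ) : MvPolynomial (Fin N) ℝ →ₗ[ℝ] ℝ :=
  cubeIntegral (Fin N) ∘ₗ LinearMap.mulRight ℝ (vandermondeSq N ℝ)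

lemma legendreFunctional_apply (f : MvPolynomial (Fin N) ℝ) :
    legendreFunctional N f = cubeIntegral (Fin N) (f * vandermondeSq N ℝ) := rfl

/-- The loop (Schwinger–Dyson) equations: `E` annihilates the divergences, relative to `Δ²`, of
the vector fields `∑ᵢ xᵢ^(k+1) (1 - xᵢ) f ∂ᵢ` with `f` symmetric. -/
def SatisfiesLoopEquations (E : MvPolynomial (Fin N) ℝ →ₗ[ℝ] ℝ) : Prop :=
  ∀ (k : ℕ) (f : MvPolynomial (Fin N) ℝ), f.IsSymmetric → E (loopOp k f) = E (loopOp (k + 1) f)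

/-- The divergence `∑ᵢ ∂ᵢ(xᵢ (1 - xᵢ) f (∂ᵢ g) Δ²)`, which for `f = 1` is `Δ²` times the Jacobi
operator of the Legendre ensemble applied to `g`. -/
def jacobiDiv (f g : MvPolynomial (Fin N) ℝ) : MvPolynomial (Fin N) ℝ :=
  ∑ i, pderiv i (MvPolynomial.X i * (1 - MvPolynomial.X i) * (f * pderiv i g * vandermondeSq N ℝ))

lemma jacobiDiv_add (f g h : MvPolynomial (Fin N) ℝ) :
    jacobiDiv f (g + h) = jacobiDiv f g + jacobiDiv f h := by
  simp only [jacobiDiv, map_add, mul_add, add_mul, Finset.sum_add_distrib]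

lemma jacobiDiv_mul (f g h : MvPolynomial (Fin N) ℝ) :
    jacobiDiv f (g * h) = jacobiDiv (f * h) g + jacobiDiv (f * g) h := by
  rw [jacobiDiv, jacobiDiv, jacobiDiv, ← Finset.sum_add_distrib]
  refine Finset.sum_congr rfl fun i _ => ?_
  rw [← map_add, MvPolynomial.pderiv_mul (f := g)]
  congr 1
  ring

lemma jacobiDiv_psum_succ (f : MvPolynomial (Fin N) ℝ) (k : ℕ) :
    jacobiDiv f (psum (Fin N) ℝ (k + 1)) =
      (k + 1 : ℝ) • (loopOp k f - loopOp (k + 1) f) * vandermondeSq N ℝ := by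
  rw [smul_mul_assoc, sub_mul, ← sum_pderiv_X_pow_mul_mul_vandermondeSq,
    ← sum_pderiv_X_pow_mul_mul_vandermondeSq, ← Finset.sum_sub_distrib, Finset.smul_sum, jacobiDiv]
  refine Finset.sum_congr rfl fun i _ => ?_
  rw [← map_sub, ← Derivation.map_smul, pderiv_psum_succ, MvPolynomial.smul_eq_C_mul]
  congr 1
  simp only [map_add, map_natCast, map_one]
  ring

lemma SatisfiesLoopEquations.exists_jacobiDiv_eq {E : MvPolynomial (Fin N) ℝ →ₗ[ℝ] ℝ}
    (hE : SatisfiesLoopEquations E) {f g : MvPolynomial (Fin N) ℝ} (hf : f.IsSymmetric)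
    (hg : g.IsSymmetric) :
    ∃ p : MvPolynomial (Fin N) ℝ, p.IsSymmetric ∧ E p = 0 ∧
      jacobiDiv f g = p * vandermondeSq N ℝ := by
  have hg' : g ∈ Algebra.adjoin ℝ (Set.range fun j : ℕ => psum (Fin N) ℝ (j + 1)) := by
    rwa [adjoin_psum_eq_symmetricSubalgebra]
  clear hg
  induction hg' using Algebra.adjoin_induction generalizing f with
  | mem g hg =>
    obtain ⟨k, rfl⟩ := hg
    refine ⟨_, ?_, ?_, jacobiDiv_psum_succ f k⟩
    · exact ((isSymmetric_loopOp hf k).sub (isSymmetric_loopOp hf (k + 1))).smul _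
    · rw [map_smul, map_sub, hE k f hf, sub_self, smul_zero]
  | algebraMap c =>
    refine ⟨0, MvPolynomial.IsSymmetric.zero, map_zero E, ?_⟩
    simp [jacobiDiv, MvPolynomial.algebraMap_eq]
  | add g h _ _ ihg ihh =>
    obtain ⟨p, hp, hEp, hpg⟩ := ihg hf
    obtain ⟨q, hq, hEq, hqh⟩ := ihh hf
    exact ⟨p + q, hp.add hq, by rw [map_add, hEp, hEq, add_zero],
      by rw [jacobiDiv_add, hpg, hqh, add_mul]⟩
  | mul g h hg hh ihg ihh =>
    rw [adjoin_psum_eq_symmetricSubalgebra] at hg hh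
    obtain ⟨p, hp, hEp, hpg⟩ := ihg (f := f * h) (hf.mul hh)
    obtain ⟨q, hq, hEq, hqh⟩ := ihh (f := f * g) (hf.mul hg)
    exact ⟨p + q, hp.add hq, by rw [map_add, hEp, hEq, add_zero],
      by rw [jacobiDiv_mul, hpg, hqh, add_mul]⟩

lemma cubeIntegral_mul_jacobiDiv_one (g h : MvPolynomial (Fin N) ℝ) :
    cubeIntegral (Fin N) (h * jacobiDiv 1 g) =
      -∑ i, legendreFunctional N
        (MvPolynomial.X i * (1 - MvPolynomial.X i) * (pderiv i h * pderiv i g)) := by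
  have hleibniz (i : Fin N) : h * pderiv i (MvPolynomial.X i * (1 - MvPolynomial.X i) *
        (1 * pderiv i g * vandermondeSq N ℝ)) =
      pderiv i (MvPolynomial.X i * (1 - MvPolynomial.X i) * (h * pderiv i g * vandermondeSq N ℝ)) -
        MvPolynomial.X i * (1 - MvPolynomial.X i) * (pderiv i h * pderiv i g) *
          vandermondeSq N ℝ := by
    have hcomm : MvPolynomial.X i * (1 - MvPolynomial.X i) * (h * pderiv i g * vandermondeSq N ℝ) =
        h * (MvPolynomial.X i * (1 - MvPolynomial.X i) * (pderiv i g * vandermondeSq N ℝ)) := by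
      ring
    rw [one_mul, hcomm, MvPolynomial.pderiv_mul (f := h)]
    ring
  simp only [jacobiDiv, Finset.mul_sum, hleibniz, map_sum, map_sub,
    cubeIntegral_pderiv_X_mul_one_sub_X_mul, zero_sub, Finset.sum_neg_distrib,
    legendreFunctional_apply]

lemma totalDegree_jacobiDiv_one_le (g : MvPolynomial (Fin N) ℝ) :
    (jacobiDiv 1 g).totalDegree ≤ g.totalDegree + (vandermondeSq N ℝ).totalDegree := by
  refine MvPolynomial.totalDegree_finsetSum_le fun i _ => ?_
  by_cases houter : pderiv i (MvPolynomial.X i * (1 - MvPolynomial.X i) *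
      (1 * pderiv i g * vandermondeSq N ℝ)) = 0
  · rw [houter, MvPolynomial.totalDegree_zero]
    exact Nat.zero_le _
  have hinner : pderiv i g ≠ 0 := fun h => houter (by simp [h])
  have hg := totalDegree_pderiv_lt hinner
  have hlt := totalDegree_pderiv_lt houter
  have hX :
      (MvPolynomial.X i * (1 - MvPolynomial.X i) : MvPolynomial (Fin N) ℝ).totalDegree ≤ 2 := by
    refine (MvPolynomial.totalDegree_mul _ _).trans (add_le_add (b := 1) (d := 1) ?_ ?_)
    · exact (MvPolynomial.totalDegree_X i).le
    · exact (MvPolynomial.totalDegree_sub _ _).trans (by simp)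
  have hmul := MvPolynomial.totalDegree_mul (MvPolynomial.X i * (1 - MvPolynomial.X i))
    (1 * pderiv i g * vandermondeSq N ℝ)
  have hmul' := MvPolynomial.totalDegree_mul (pderiv i g) (vandermondeSq N ℝ)
  rw [one_mul] at hmul hlt ⊢
  omega

variable (N) in
/-- The symmetric polynomials of total degree at most `n`. -/
def symmetricOfDegreeLE (n : ℕ) : Submodule ℝ (MvPolynomial (Fin N) ℝ) :=
  MvPolynomial.restrictTotalDegree (Fin N) ℝ n ⊓ (symmetricSubalgebra (Fin N) ℝ).toSubmodule

instance (n : ℕ) : FiniteDimensional ℝ (symmetricOfDegreeLE N n) :=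
  Submodule.finiteDimensional_inf_left _ _

lemma eq_zero_of_legendreFunctional_mul_self_eq_zero {f : MvPolynomial (Fin N) ℝ}
    (h : legendreFunctional N (f * f) = 0) : f = 0 := by
  have hnonneg (x : Fin N → ℝ) : 0 ≤ MvPolynomial.eval x (f * f * vandermondeSq N ℝ) := by
    rw [map_mul, map_mul, eval_vandermondeSq]
    exact mul_nonneg (mul_self_nonneg _) (sq_nonneg _)
  have hzero := eq_zero_of_cubeIntegral_eq_zero (fun x _ => hnonneg x) h
  exact mul_self_eq_zero.1 ((mul_eq_zero.1 hzero).resolve_right vandermondeSq_ne_zero)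

lemma exists_legendreFunctional_mul_eq (E : MvPolynomial (Fin N) ℝ →ₗ[ℝ] ℝ) (n : ℕ) :
    ∃ h ∈ symmetricOfDegreeLE N n, ∀ f ∈ symmetricOfDegreeLE N n,
      E f = legendreFunctional N (h * f) := by
  let B := ((LinearMap.mul ℝ _).compr₂ (legendreFunctional N)).domRestrict₁₂
    (symmetricOfDegreeLE N n) (symmetricOfDegreeLE N n)
  obtain ⟨h, hh⟩ := exists_forall_apply_eq_of_anisotropic B
    (fun v hv => Subtype.ext (eq_zero_of_legendreFunctional_mul_self_eq_zero hv))
    (E.domRestrict (symmetricOfDegreeLE N n))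
  exact ⟨h, h.2, fun f hf => hh ⟨f, hf⟩⟩

lemma forall_pderiv_eq_zero_of_sum_legendreFunctional_eq_zero {h : MvPolynomial (Fin N) ℝ}
    (hsum : ∑ i, legendreFunctional N
      (MvPolynomial.X i * (1 - MvPolynomial.X i) * (pderiv i h * pderiv i h)) = 0) (i : Fin N) :
    pderiv i h = 0 := by
  have hnonneg (i : Fin N) : ∀ x ∈ Set.Icc (0 : Fin N → ℝ) 1, 0 ≤ MvPolynomial.eval x
      (MvPolynomial.X i * (1 - MvPolynomial.X i) * (pderiv i h * pderiv i h) *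
        vandermondeSq N ℝ) := by
    intro x hx
    have := mul_nonneg (hx.1 i) (sub_nonneg.2 (hx.2 i))
    simp only [map_mul, map_sub, map_one, MvPolynomial.eval_X, eval_vandermondeSq]
    exact mul_nonneg (mul_nonneg this (mul_self_nonneg _)) (sq_nonneg _)
  have hzero := eq_zero_of_cubeIntegral_eq_zero (hnonneg i)
    ((Finset.sum_eq_zero_iff_of_nonneg fun i _ => cubeIntegral_nonneg (hnonneg i)).1 hsum i
      (Finset.mem_univ i))
  have hX : (1 - MvPolynomial.X i : MvPolynomial (Fin N) ℝ) ≠ 0 := fun h0 => by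
    simpa using congrArg (MvPolynomial.eval 0) h0
  simpa [MvPolynomial.X_ne_zero, hX, vandermondeSq_ne_zero] using hzero

/-- The Riesz representative `h` of `E` on symmetric polynomials of bounded degree has zero
Dirichlet energy, since the loop equations make `E` vanish on the Jacobi operator applied to `h`. -/
theorem SatisfiesLoopEquations.apply_mul_legendreFunctional_one
    {E : MvPolynomial (Fin N) ℝ →ₗ[ℝ] ℝ} (hE : SatisfiesLoopEquations E)
    {f : MvPolynomial (Fin N) ℝ} (hf : f.IsSymmetric) :
    E f * legendreFunctional N 1 = E 1 * legendreFunctional N f := by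
  obtain ⟨h, ⟨hdeg, hsymm⟩, hrep⟩ := exists_legendreFunctional_mul_eq E f.totalDegree
  rw [SetLike.mem_coe, MvPolynomial.mem_restrictTotalDegree] at hdeg
  obtain ⟨p, hp, hEp, hdiv⟩ := hE.exists_jacobiDiv_eq MvPolynomial.IsSymmetric.one hsymm
  have hp_mem : p ∈ symmetricOfDegreeLE N f.totalDegree := by
    refine ⟨(MvPolynomial.mem_restrictTotalDegree ..).2 ?_, hp⟩
    by_cases hp0 : p = 0
    · simp [hp0]
    have hle := totalDegree_jacobiDiv_one_le h
    rw [hdiv, MvPolynomial.totalDegree_mul_of_isDomain hp0 vandermondeSq_ne_zero] at hle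
    omega
  have henergy := cubeIntegral_mul_jacobiDiv_one h h
  rw [hdiv, ← mul_assoc, ← legendreFunctional_apply, ← hrep p hp_mem, hEp, zero_eq_neg] at henergy
  have hconst := eq_C_of_forall_pderiv_eq_zero
    (forall_pderiv_eq_zero_of_sum_legendreFunctional_eq_zero henergy)
  have happly (g : MvPolynomial (Fin N) ℝ) (hg : g ∈ symmetricOfDegreeLE N f.totalDegree) :
      E g = MvPolynomial.coeff 0 h * legendreFunctional N g := by
    rw [hrep g hg, hconst, MvPolynomial.coeff_C, if_pos rfl, MvPolynomial.C_mul', map_smul,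
      smul_eq_mul]
  rw [happly f ⟨(MvPolynomial.mem_restrictTotalDegree ..).2 le_rfl, hf⟩,
    happly 1 ⟨(MvPolynomial.mem_restrictTotalDegree ..).2 (by simp), MvPolynomial.IsSymmetric.one⟩]
  ring

end LoopEquations

section LeftDerivative

lemma integral_eq_zero_of_hasDerivAt_mul_left {G E : Type*} [Group G] [TopologicalSpace G]
    [IsTopologicalGroup G] [CompactSpace G] [MeasurableSpace G] [BorelSpace G]
    [NormedAddCommGroup E] [NormedSpace ℝ E] (μ : Measure G) [IsFiniteMeasure μ]
    [μ.IsMulLeftInvariant] {γ : ℝ → G} (hγ : ∀ s t, γ (s + t) = γ s * γ t) {F F' : G → E}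
    (hF : Continuous F) (hF' : Continuous F')
    (hderiv : ∀ U, HasDerivAt (fun s => F (γ s * U)) (F' U) 0) : ∫ U, F' U ∂μ = 0 := by
  have hγ_zero : γ 0 = 1 := mul_eq_left.1 ((hγ 0 0).symm.trans (by rw [add_zero]))
  have hderiv_at (t : ℝ) (U : G) : HasDerivAt (fun s => F (γ s * U)) (F' (γ t * U)) t := by
    have hshift := HasDerivAt.comp_sub_const t t (by simpa using hderiv (γ t * U))
    simpa only [← mul_assoc, ← hγ, sub_add_cancel] using hshift
  have hintegrable {f : G → E} (hf : Continuous f) : Integrable f μ :=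
    hf.integrable_of_hasCompactSupport (HasCompactSupport.of_compactSpace f)
  obtain ⟨C, hC⟩ := isCompact_univ.exists_bound_of_continuousOn hF'.continuousOn
  have hdiff := (hasDerivAt_integral_of_dominated_loc_of_deriv_le (μ := μ) (bound := fun _ => C)
    (F := fun t U => F (γ t * U)) (F' := fun t U => F' (γ t * U)) (x₀ := (0 : ℝ))
    Filter.univ_mem (.of_forall fun t => (hintegrable (by fun_prop)).aestronglyMeasurable)
    (hintegrable (by fun_prop)) (hintegrable (by fun_prop)).aestronglyMeasurable
    (.of_forall fun U t _ => hC _ (Set.mem_univ _)) (integrable_const C)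
    (.of_forall fun U t _ => hderiv_at t U)).2
  simp only [integral_mul_left_eq_self F, hγ_zero, one_mul] at hdiff
  exact hdiff.unique (hasDerivAt_const 0 _)

open scoped ComplexStarModule

variable {A E : Type*} [CStarAlgebra A]

/-- `F'` is the continuous derivative of `F` under infinitesimal left translation by the
skew-adjoint element `i h`. -/
structure HasDerivAlong [NormedAddCommGroup E] [NormedSpace ℝ E] (h : selfAdjoint A)
    (F F' : unitary A → E) : Prop where
  continuous : Continuous F
  continuous_deriv : Continuous F'
  hasDerivAt : ∀ U, HasDerivAt (fun s : ℝ => F (selfAdjoint.expUnitary (s • h) * U)) (F' U) 0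

/-- `F'` is the continuous derivative of `F` under infinitesimal left translation by `Y`, the
derivatives along skew-adjoint elements being extended complex linearly: it is
`D_{iℑY} F - i D_{iℜY} F`, as `Y = iℑY - i (iℜY)`. -/
def HasLeftDeriv [NormedAddCommGroup E] [NormedSpace ℂ E] (Y : A) (F F' : unitary A → E) : Prop :=
  ∃ F₁ F₂, HasDerivAlong (ℜ Y) F F₁ ∧ HasDerivAlong (ℑ Y) F F₂ ∧
    F' = fun U => F₂ U - Complex.I • F₁ U

lemma HasDerivAlong.integral_eq_zero [CompactSpace (unitary A)] [MeasurableSpace (unitary A)]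
    [BorelSpace (unitary A)] [NormedAddCommGroup E] [NormedSpace ℝ E] {h : selfAdjoint A}
    {F F' : unitary A → E} (hF : HasDerivAlong h F F') (μ : Measure (unitary A))
    [IsFiniteMeasure μ] [μ.IsMulLeftInvariant] : ∫ U, F' U ∂μ = 0 := by
  refine integral_eq_zero_of_hasDerivAt_mul_left μ
    (γ := fun s => selfAdjoint.expUnitary (s • h)) (fun s t => ?_) hF.continuous
    hF.continuous_deriv hF.hasDerivAt
  rw [add_smul]
  exact Commute.expUnitary_add ((Commute.refl (h : A)).smul_left s |>.smul_right t)

theorem HasLeftDeriv.integral_eq_zero [CompactSpace (unitary A)] [MeasurableSpace (unitary A)]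
    [BorelSpace (unitary A)] [NormedAddCommGroup E] [NormedSpace ℂ E] {Y : A}
    {F F' : unitary A → E} (hF : HasLeftDeriv Y F F') (μ : Measure (unitary A))
    [IsFiniteMeasure μ] [μ.IsMulLeftInvariant] : ∫ U, F' U ∂μ = 0 := by
  obtain ⟨F₁, F₂, h₁, h₂, rfl⟩ := hF
  have hintegrable {f : unitary A → E} (hf : Continuous f) : Integrable f μ :=
    hf.integrable_of_hasCompactSupport (HasCompactSupport.of_compactSpace f)
  calc ∫ U, F₂ U - Complex.I • F₁ U ∂μ
      = ∫ U, F₂ U ∂μ - ∫ U, Complex.I • F₁ U ∂μ :=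
        integral_sub (hintegrable h₂.continuous_deriv)
          (hintegrable (h₁.continuous_deriv.const_smul _))
    _ = 0 := by
        rw [integral_smul, h₁.integral_eq_zero μ, h₂.integral_eq_zero μ, smul_zero, sub_zero]

section Rules

lemma HasDerivAlong.clm_comp {E' : Type*} [NormedAddCommGroup E] [NormedSpace ℝ E]
    [NormedAddCommGroup E'] [NormedSpace ℝ E'] {h : selfAdjoint A} {F F' : unitary A → E}
    (hF : HasDerivAlong h F F') (L : E →L[ℝ] E') :
    HasDerivAlong h (fun U => L (F U)) (fun U => L (F' U)) :=
  ⟨L.continuous.comp hF.continuous, L.continuous.comp hF.continuous_deriv, fun U =>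
    L.hasFDerivAt.comp_hasDerivAt 0 (hF.hasDerivAt U)⟩

lemma HasDerivAlong.add [NormedAddCommGroup E] [NormedSpace ℝ E] {h : selfAdjoint A}
    {F F' G G' : unitary A → E} (hF : HasDerivAlong h F F') (hG : HasDerivAlong h G G') :
    HasDerivAlong h (F + G) (F' + G') :=
  ⟨hF.continuous.add hG.continuous, hF.continuous_deriv.add hG.continuous_deriv, fun U =>
    (hF.hasDerivAt U).add (hG.hasDerivAt U)⟩

lemma HasDerivAlong.mul [NormedRing E] [NormedAlgebra ℝ E] {h : selfAdjoint A}
    {F F' G G' : unitary A → E} (hF : HasDerivAlong h F F') (hG : HasDerivAlong h G G') :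
    HasDerivAlong h (F * G) (F' * G + F * G') :=
  ⟨hF.continuous.mul hG.continuous, (hF.continuous_deriv.mul hG.continuous).add
    (hF.continuous.mul hG.continuous_deriv), fun U => by
      simpa using (hF.hasDerivAt U).fun_mul (hG.hasDerivAt U)⟩

lemma hasDerivAlong_const [NormedAddCommGroup E] [NormedSpace ℝ E] (h : selfAdjoint A) (c : E) :
    HasDerivAlong h (fun _ => c) (fun _ => 0) :=
  ⟨continuous_const, continuous_const, fun _ => hasDerivAt_const 0 c⟩

lemma hasDerivAlong_coe (h : selfAdjoint A) :
    HasDerivAlong h (fun U => (U : A)) (fun U => Complex.I • (h : A) * U) where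
  continuous := continuous_subtype_val
  continuous_deriv := continuous_const.mul continuous_subtype_val
  hasDerivAt U := by
    have hexp := (hasDerivAt_exp_smul_const (𝕂 := ℝ) (Complex.I • (h : A)) 0).mul_const (U : A)
    simpa [selfAdjoint.expUnitary_coe, smul_comm Complex.I] using hexp

lemma HasDerivAlong.star {h : selfAdjoint A} {F F' : unitary A → A} (hF : HasDerivAlong h F F') :
    HasDerivAlong h (fun U => star (F U)) (fun U => star (F' U)) :=
  ⟨hF.continuous.star, hF.continuous_deriv.star, fun U => (hF.hasDerivAt U).star⟩

variable {Y : A}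

lemma HasLeftDeriv.continuous_deriv [NormedAddCommGroup E] [NormedSpace ℂ E]
    {F F' : unitary A → E} (hF : HasLeftDeriv Y F F') : Continuous F' := by
  obtain ⟨F₁, F₂, h₁, h₂, rfl⟩ := hF
  exact h₂.continuous_deriv.sub (h₁.continuous_deriv.const_smul _)

lemma HasLeftDeriv.congr [NormedAddCommGroup E] [NormedSpace ℂ E] {F F' G G' : unitary A → E}
    (hF : HasLeftDeriv Y F F') (h : ∀ U, G U = F U) (h' : ∀ U, G' U = F' U) :
    HasLeftDeriv Y G G' := by
  rwa [funext h, funext h']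

lemma HasLeftDeriv.clm_comp {E' : Type*} [NormedAddCommGroup E] [NormedSpace ℂ E]
    [NormedAddCommGroup E'] [NormedSpace ℂ E'] {F F' : unitary A → E} (hF : HasLeftDeriv Y F F')
    (L : E →L[ℂ] E') : HasLeftDeriv Y (fun U => L (F U)) (fun U => L (F' U)) := by
  obtain ⟨F₁, F₂, h₁, h₂, rfl⟩ := hF
  exact ⟨_, _, h₁.clm_comp (L.restrictScalars ℝ), h₂.clm_comp (L.restrictScalars ℝ), by simp⟩

lemma HasLeftDeriv.add [NormedAddCommGroup E] [NormedSpace ℂ E] {F F' G G' : unitary A → E}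
    (hF : HasLeftDeriv Y F F') (hG : HasLeftDeriv Y G G') :
    HasLeftDeriv Y (F + G) (F' + G') := by
  obtain ⟨F₁, F₂, hF₁, hF₂, rfl⟩ := hF
  obtain ⟨G₁, G₂, hG₁, hG₂, rfl⟩ := hG
  refine ⟨_, _, hF₁.add hG₁, hF₂.add hG₂, funext fun U => ?_⟩
  simp only [Pi.add_apply, smul_add]
  abel

lemma HasLeftDeriv.mul [NormedRing E] [NormedAlgebra ℂ E] {F F' G G' : unitary A → E}
    (hF : HasLeftDeriv Y F F') (hG : HasLeftDeriv Y G G') :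
    HasLeftDeriv Y (F * G) (F' * G + F * G') := by
  obtain ⟨F₁, F₂, hF₁, hF₂, rfl⟩ := hF
  obtain ⟨G₁, G₂, hG₁, hG₂, rfl⟩ := hG
  refine ⟨_, _, hF₁.mul hG₁, hF₂.mul hG₂, funext fun U => ?_⟩
  simp only [Pi.add_apply, Pi.mul_apply, smul_add, sub_mul, mul_sub, smul_mul_assoc,
    mul_smul_comm]
  abel

lemma hasLeftDeriv_const [NormedAddCommGroup E] [NormedSpace ℂ E] (Y : A) (c : E) :
    HasLeftDeriv Y (fun _ => c) (fun _ => 0) :=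
  ⟨_, _, hasDerivAlong_const _ c, hasDerivAlong_const _ c, by simp⟩

lemma hasLeftDeriv_coe (Y : A) : HasLeftDeriv Y (fun U => (U : A)) (fun U => Y * U) := by
  refine ⟨_, _, hasDerivAlong_coe _, hasDerivAlong_coe _, funext fun U => ?_⟩
  conv_lhs => rw [← realPart_add_I_smul_imaginaryPart Y]
  simp only [smul_mul_assoc, add_mul, smul_smul, Complex.I_mul_I, neg_one_smul, sub_neg_eq_add]
  abel

lemma hasLeftDeriv_star_coe (Y : A) :
    HasLeftDeriv Y (fun U => star (U : A)) (fun U => -(star (U : A) * Y)) := by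
  refine ⟨_, _, (hasDerivAlong_coe _).star, (hasDerivAlong_coe _).star, funext fun U => ?_⟩
  conv_lhs => rw [← realPart_add_I_smul_imaginaryPart Y]
  simp only [star_mul, star_smul, selfAdjoint.star_val_eq, mul_add, mul_smul_comm,
    Complex.star_def, Complex.conj_I, neg_smul, smul_neg, mul_neg, smul_smul, Complex.I_mul_I,
    neg_neg, one_smul, neg_add]
  abel

end Rules

end LeftDerivative

section SpectralFunctions

open scoped Matrix.Norms.L2Operator

variable {n : Type*} [Fintype n] [DecidableEq n] {H : Matrix n n ℂ}

lemma trace_conjStarAlgAut (U : Matrix.unitaryGroup n ℂ) (B : Matrix n n ℂ) :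
    (Unitary.conjStarAlgAut ℂ _ U B).trace = B.trace := by
  rw [Unitary.conjStarAlgAut_apply, Matrix.trace_mul_cycle, Unitary.coe_star_mul_self, one_mul]

lemma isHermitian_pow_eq_conjStarAlgAut (hH : H.IsHermitian) (k : ℕ) :
    H ^ k = Unitary.conjStarAlgAut ℂ _ hH.eigenvectorUnitary
      (Matrix.diagonal fun i => (hH.eigenvalues i : ℂ) ^ k) := by
  conv_lhs => rw [hH.spectral_theorem, ← map_pow, Matrix.diagonal_pow]
  rfl

lemma trace_pow_eq_eval_psum (hH : H.IsHermitian) (k : ℕ) :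
    (H ^ k).trace = ((psum n ℝ k).eval hH.eigenvalues : ℝ) := by
  rw [isHermitian_pow_eq_conjStarAlgAut hH, trace_conjStarAlgAut, Matrix.trace_diagonal]
  simp [psum]

/-- The gradient, with respect to the trace form, of the spectral function `H ↦ f (eigenvalues H)`
of a symmetric polynomial `f`. -/
def spectralGradient (hH : H.IsHermitian) (f : MvPolynomial n ℝ) : Matrix n n ℂ :=
  Unitary.conjStarAlgAut ℂ _ hH.eigenvectorUnitary
    (Matrix.diagonal fun i => (((pderiv i f).eval hH.eigenvalues : ℝ) : ℂ))

lemma trace_spectralGradient_mul_pow (hH : H.IsHermitian) (f : MvPolynomial n ℝ) (k : ℕ) :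
    (spectralGradient hH f * H ^ k).trace =
      ((∑ i, MvPolynomial.X i ^ k * pderiv i f).eval hH.eigenvalues : ℝ) := by
  rw [isHermitian_pow_eq_conjStarAlgAut hH, spectralGradient, ← map_mul, trace_conjStarAlgAut,
    Matrix.diagonal_mul_diagonal, Matrix.trace_diagonal]
  simp [mul_comm]

lemma spectralGradient_psum_succ (hH : H.IsHermitian) (k : ℕ) :
    spectralGradient hH (psum n ℝ (k + 1)) = (k + 1 : ℂ) • H ^ k := by
  rw [spectralGradient, isHermitian_pow_eq_conjStarAlgAut hH, ← map_smul, ← Matrix.diagonal_smul]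
  congr 2 with i
  simp [pderiv_psum_succ]

lemma spectralGradient_C (hH : H.IsHermitian) (r : ℝ) :
    spectralGradient hH (MvPolynomial.C r) = 0 := by
  simp [spectralGradient]

lemma spectralGradient_add (hH : H.IsHermitian) (f g : MvPolynomial n ℝ) :
    spectralGradient hH (f + g) = spectralGradient hH f + spectralGradient hH g := by
  rw [spectralGradient, spectralGradient, spectralGradient, ← map_add, Matrix.diagonal_add]
  simp only [map_add, Complex.ofReal_add]

lemma spectralGradient_mul (hH : H.IsHermitian) (f g : MvPolynomial n ℝ) :
    spectralGradient hH (f * g) =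
      ((f.eval hH.eigenvalues : ℝ) : ℂ) • spectralGradient hH g +
      ((g.eval hH.eigenvalues : ℝ) : ℂ) • spectralGradient hH f := by
  rw [spectralGradient, spectralGradient, spectralGradient, ← map_smul, ← map_smul, ← map_add,
    ← Matrix.diagonal_smul, ← Matrix.diagonal_smul, Matrix.diagonal_add]
  simp only [Derivation.leibniz, smul_eq_mul, map_add, map_mul, Complex.ofReal_add,
    Complex.ofReal_mul, Pi.smul_apply]

variable {A : Type*} [CStarAlgebra A] {Y : A}

lemma HasLeftDeriv.pow_succ {R : Type*} [NormedRing R] [NormedAlgebra ℂ R]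
    {F F' : unitary A → R} (hF : HasLeftDeriv Y F F') (k : ℕ) :
    HasLeftDeriv Y (F ^ (k + 1)) (∑ p ∈ antidiagonal k, F ^ p.1 * F' * F ^ p.2) := by
  induction k with
  | zero => simpa using hF
  | succ k ih =>
    rw [Finset.Nat.sum_antidiagonal_succ', _root_.pow_succ F (k + 1),
      add_comm (F ^ (k + 1) * F' * _)]
    convert ih.mul hF using 2
    · simp only [Finset.sum_mul, mul_assoc, _root_.pow_succ]
    · rw [pow_zero, mul_one]

lemma HasLeftDeriv.trace {F F' : unitary A → Matrix n n ℂ} (hF : HasLeftDeriv Y F F') :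
    HasLeftDeriv Y (fun U => (F U).trace) (fun U => (F' U).trace) :=
  hF.clm_comp (Matrix.traceLinearMap n ℂ ℂ).toContinuousLinearMap

lemma HasLeftDeriv.trace_pow_succ {F F' : unitary A → Matrix n n ℂ} (hF : HasLeftDeriv Y F F')
    (k : ℕ) :
    HasLeftDeriv Y (fun U => (F U ^ (k + 1)).trace)
      (fun U => ((k + 1 : ℂ) • F U ^ k * F' U).trace) := by
  refine (hF.pow_succ k).trace.congr (fun U => rfl) fun U => ?_
  have hcycle : ∀ p ∈ antidiagonal k,
      (F U ^ p.1 * F' U * F U ^ p.2).trace = (F U ^ k * F' U).trace := fun p hp => by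
    rw [Matrix.trace_mul_cycle, ← pow_add, add_comm, mem_antidiagonal.1 hp]
  have hsum : (∑ p ∈ antidiagonal k, F ^ p.1 * F' * F ^ p.2) U =
      ∑ p ∈ antidiagonal k, F U ^ p.1 * F' U * F U ^ p.2 := Finset.sum_apply _ _ _
  rw [hsum, Matrix.trace_sum, Finset.sum_congr rfl hcycle]
  simp [Matrix.trace_smul]

theorem HasLeftDeriv.eval_eigenvalues {F F' : unitary A → Matrix n n ℂ}
    (hF : HasLeftDeriv Y F F') (hH : ∀ U, (F U).IsHermitian) {f : MvPolynomial n ℝ}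
    (hf : f.IsSymmetric) :
    HasLeftDeriv Y (fun U => ((f.eval (hH U).eigenvalues : ℝ) : ℂ))
      (fun U => (spectralGradient (hH U) f * F' U).trace) := by
  replace hf : f ∈ symmetricSubalgebra n ℝ := hf
  rw [← adjoin_psum_eq_symmetricSubalgebra] at hf
  induction hf using Algebra.adjoin_induction with
  | mem g hg =>
    obtain ⟨k, rfl⟩ := hg
    simpa only [spectralGradient_psum_succ, trace_pow_eq_eval_psum (hH _)] using
      hF.trace_pow_succ k
  | algebraMap r =>
    simpa [MvPolynomial.algebraMap_eq, spectralGradient_C] using hasLeftDeriv_const Y (r : ℂ)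
  | add f g _ _ ihf ihg =>
    refine (ihf.add ihg).congr (fun U => ?_) fun U => ?_
    · simp
    · simp [spectralGradient_add, add_mul]
  | mul f g _ _ ihf ihg =>
    refine (ihf.mul ihg).congr (fun U => ?_) fun U => ?_
    · simp
    · simp [spectralGradient_mul, add_mul, mul_comm, add_comm]

end SpectralFunctions

section EigenvalueContinuity

open Matrix

lemma eq_of_antitone_of_map_univ_eq {α : Type*} [LinearOrder α] {k : ℕ} {x y : Fin k → α}
    (hx : Antitone x) (hy : Antitone y)
    (h : Finset.univ.val.map x = Finset.univ.val.map y) : x = y := by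
  rw [Fin.univ_val_map, Fin.univ_val_map, Multiset.coe_eq_coe] at h
  exact List.ofFn_injective (h.eq_of_sortedGE hx.sortedGE_ofFn hy.sortedGE_ofFn)

lemma map_univ_eq_of_forall_eval_eq {σ R : Type*} [Fintype σ] [CommRing R] [IsDomain R]
    [Infinite R] {x y : σ → R}
    (h : ∀ f : MvPolynomial σ R, f.IsSymmetric → f.eval x = f.eval y) :
    Finset.univ.val.map x = Finset.univ.val.map y := by
  have hsymm (z : R) : (∏ i : σ, (MvPolynomial.C z - MvPolynomial.X i)).IsSymmetric := fun e => by
    simpa using Equiv.prod_comp e fun i => MvPolynomial.C (R := R) z - MvPolynomial.X i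
  have hprod : ∏ i, (X - C (x i)) = ∏ i, (X - C (y i)) := Polynomial.funext fun z => by
    simpa [Polynomial.eval_prod] using h _ (hsymm z)
  have hroots (u : σ → R) : (∏ i, (X - C (u i))).roots = Finset.univ.val.map u := by
    simpa using Polynomial.roots_multiset_prod_X_sub_C (Finset.univ.val.map u)
  rw [← hroots x, ← hroots y, hprod]

variable {X n : Type*} [TopologicalSpace X] [Fintype n] [DecidableEq n] {F : X → Matrix n n ℂ}

lemma continuous_eval_eigenvalues (hF : Continuous F) (hH : ∀ x, (F x).IsHermitian)
    {f : MvPolynomial n ℝ} (hf : f.IsSymmetric) :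
    Continuous fun x => f.eval (hH x).eigenvalues := by
  replace hf : f ∈ symmetricSubalgebra n ℝ := hf
  rw [← adjoin_psum_eq_symmetricSubalgebra] at hf
  induction hf using Algebra.adjoin_induction with
  | mem g hg =>
    obtain ⟨k, rfl⟩ := hg
    simpa only [Function.comp_def, Pi.pow_apply, trace_pow_eq_eval_psum (hH _), Complex.ofReal_re]
      using Complex.continuous_re.comp (hF.pow (k + 1)).matrix_trace
  | algebraMap r => simpa [MvPolynomial.algebraMap_eq] using continuous_const
  | add f g _ _ ihf ihg => simpa using ihf.fun_add ihg
  | mul f g _ _ ihf ihg => simpa using ihf.fun_mul ihg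

lemma antitone_eigenvalues_comp_equivOfCardEq {H : Matrix n n ℂ} (hH : H.IsHermitian) :
    Antitone (hH.eigenvalues ∘ Fintype.equivOfCardEq (Fintype.card_fin _)) := fun i j hij => by
  simpa [Matrix.IsHermitian.eigenvalues] using hH.eigenvalues₀_antitone hij

/-- Near a point the eigenvalues stay in a ball, by continuity of the sum of their squares, and a
cluster point of them is determined by its order and the values of the symmetric polynomials. -/
theorem continuous_eigenvalues (hF : Continuous F) (hH : ∀ x, (F x).IsHermitian) :
    Continuous fun x => (hH x).eigenvalues := by
  set e : Fin (Fintype.card n) ≃ n := Fintype.equivOfCardEq (Fintype.card_fin _)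
  rw [continuous_iff_continuousAt]
  intro x₀
  have htendsto {f : MvPolynomial n ℝ} (hf : f.IsSymmetric) :=
    (continuous_eval_eigenvalues hF hH hf).tendsto x₀
  set r := (psum n ℝ 2).eval (hH x₀).eigenvalues + 1 with hr
  have hr_one : 1 ≤ r := by
    simpa [hr, psum] using Finset.sum_nonneg fun i _ => sq_nonneg ((hH x₀).eigenvalues i)
  have hbounded : ∀ᶠ x in nhds x₀, (hH x).eigenvalues ∈ Metric.closedBall 0 r := by
    filter_upwards [(htendsto (MvPolynomial.psum_isSymmetric n ℝ 2)).eventually_le_const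
      (lt_add_one _)] with x hx
    rw [mem_closedBall_zero_iff, pi_norm_le_iff_of_nonneg (by linarith)]
    refine fun i => abs_le_of_sq_le_sq ?_ (by linarith)
    calc (hH x).eigenvalues i ^ 2 ≤ ∑ j, (hH x).eigenvalues j ^ 2 :=
          Finset.single_le_sum (fun j _ => sq_nonneg _) (Finset.mem_univ i)
      _ ≤ r := by simpa [psum, hr] using hx
      _ ≤ r ^ 2 := le_self_pow₀ hr_one two_ne_zero
  refine (isCompact_closedBall _ _).tendsto_nhds_of_unique_mapClusterPt hbounded fun y _ hy => ?_
  have heval (f : MvPolynomial n ℝ) (hf : f.IsSymmetric) : f.eval y = f.eval (hH x₀).eigenvalues :=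
    eq_of_nhds_neBot <| (hy.continuousAt_comp f.continuous_eval.continuousAt).neBot.mono <|
      inf_le_inf_left _ (htendsto hf)
  have hanti : Antitone (y ∘ e) :=
    (isClosed_antitone.preimage (Pi.continuous_precomp e)).mem_of_mapClusterPt hy
      (.of_forall fun x => antitone_eigenvalues_comp_equivOfCardEq (hH x))
  refine e.surjective.injective_comp_right <| eq_of_antitone_of_map_univ_eq hanti
    (antitone_eigenvalues_comp_equivOfCardEq (hH x₀)) ?_
  have hmap (u : n → ℝ) : Finset.univ.val.map (u ∘ e) = Finset.univ.val.map u := by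
    rw [← Multiset.map_map, ← Finset.map_univ_equiv e]; rfl
  rw [hmap, hmap, map_univ_eq_of_forall_eval_eq heval]

end EigenvalueContinuity

section EigenvalueFunctional

open Matrix
open scoped Matrix.Norms.L2Operator

instance instCompactSpaceUnitaryGroup {n : Type*} [Fintype n] [DecidableEq n] :
    CompactSpace (Matrix.unitaryGroup n ℂ) := by
  refine isCompact_iff_compactSpace.1 (Metric.isCompact_of_isClosed_isBounded isClosed_unitary ?_)
  refine Metric.isBounded_iff_subset_closedBall 0 |>.2 ⟨‖(1 : Matrix n n ℂ)‖, fun U hU => ?_⟩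
  rw [mem_closedBall_zero_iff, ← CStarRing.norm_mem_unitary_mul 1 hU, mul_one]

variable {M N : ℕ} [NeZero M]

lemma continuous_block :
    Continuous (block : Matrix.unitaryGroup (Fin M × Fin N) ℂ → Matrix (Fin N) (Fin N) ℂ) :=
  continuous_subtype_val.matrix_submatrix _ _

lemma continuous_eigenvalues_block :
    Continuous (eigenvalues : Matrix.unitaryGroup (Fin M × Fin N) ℂ → Fin N → ℝ) :=
  continuous_eigenvalues (continuous_block.matrix_conjTranspose.matrix_mul continuous_block) _

lemma integrable_eval_eigenvalues (μ : Measure (Matrix.unitaryGroup (Fin M × Fin N) ℂ))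
    [IsFiniteMeasure μ] (f : MvPolynomial (Fin N) ℝ) :
    Integrable (fun U => f.eval (eigenvalues U)) μ :=
  (f.continuous_eval.comp continuous_eigenvalues_block).integrable_of_hasCompactSupport
    (HasCompactSupport.of_compactSpace _)

/-- The expectation of a polynomial in the eigenvalues of `A† A`, as a linear functional. -/
def eigenvalueFunctional (μ : Measure (Matrix.unitaryGroup (Fin M × Fin N) ℂ))
    [IsFiniteMeasure μ] : MvPolynomial (Fin N) ℝ →ₗ[ℝ] ℝ where
  toFun f := ∫ U, f.eval (eigenvalues U) ∂μ
  map_add' f g := by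
    simpa using integral_add (integrable_eval_eigenvalues μ f) (integrable_eval_eigenvalues μ g)
  map_smul' c f := by simpa using integral_const_mul c fun U => f.eval (eigenvalues U)

lemma eigenvalueFunctional_apply (μ : Measure (Matrix.unitaryGroup (Fin M × Fin N) ℂ))
    [IsFiniteMeasure μ] (f : MvPolynomial (Fin N) ℝ) :
    eigenvalueFunctional μ f = ∫ U, f.eval (eigenvalues U) ∂μ := rfl

end EigenvalueFunctional

section HaarLoopEquations

open Matrix
open scoped Matrix.Norms.L2Operator

section SingleSums

variable {n R : Type*} [Fintype n] [DecidableEq n] [CommRing R]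

lemma sum_mul_single_mul_apply (P Q : Matrix n n R) :
    ∑ a, ∑ b, (P * (Matrix.single a b 1 : Matrix n n R) * Q) a b = P.trace * Q.trace := by
  simp [Matrix.trace, Finset.sum_mul_sum, Matrix.mul_apply, Matrix.single_apply, ite_and]

lemma sum_trace_mul_single_mul_mul_apply (P Q B : Matrix n n R) :
    ∑ a, ∑ b, (P * (Matrix.single a b 1 : Matrix n n R) * Q).trace * B a b =
      (Q * P * B).trace := by
  have htrace (a b : n) :
      (P * (Matrix.single a b 1 : Matrix n n R) * Q).trace = (Q * P) b a := by
    simp [Matrix.trace_mul_cycle P, Matrix.trace_mul_single]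
  simp_rw [htrace, Matrix.trace, Matrix.diag_apply, Matrix.mul_apply (N := B)]
  exact Finset.sum_comm

end SingleSums

variable {N : ℕ}

/-- The lower left `N × N` block of `U`. -/
def lowerBlock (U : Matrix.unitaryGroup (Fin 2 × Fin N) ℂ) : Matrix (Fin N) (Fin N) ℂ :=
  (U : Matrix (Fin 2 × Fin N) (Fin 2 × Fin N) ℂ).submatrix (fun i => (1, i)) (fun j => (0, j))

lemma conjTranspose_lowerBlock_mul_lowerBlock (U : Matrix.unitaryGroup (Fin 2 × Fin N) ℂ) :
    (lowerBlock U)ᴴ * lowerBlock U = 1 - (block U)ᴴ * block U := by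
  rw [eq_sub_iff_add_eq, add_comm]
  ext i j
  have := congr_fun₂ (Unitary.coe_star_mul_self U) (0, i) (0, j)
  simpa [Matrix.mul_apply, Matrix.one_apply, Fintype.sum_prod_type, block, lowerBlock] using this

lemma trace_lowerBlock_mul_mul_conjTranspose (U : Matrix.unitaryGroup (Fin 2 × Fin N) ℂ)
    (B : Matrix (Fin N) (Fin N) ℂ) :
    (lowerBlock U * B * (lowerBlock U)ᴴ).trace = B.trace - (B * ((block U)ᴴ * block U)).trace := by
  rw [Matrix.trace_mul_cycle, conjTranspose_lowerBlock_mul_lowerBlock, sub_mul, one_mul,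
    Matrix.trace_sub, Matrix.trace_mul_comm _ B]

lemma trace_mul_conjTranspose_pow (B : Matrix (Fin N) (Fin N) ℂ) (k : ℕ) :
    ((B * Bᴴ) ^ k).trace = ((Bᴴ * B) ^ k).trace := by
  cases k with
  | zero => simp
  | succ k => rw [pow_succ', mul_assoc, Matrix.trace_mul_comm, ← mul_pow_mul, mul_assoc, pow_succ]

section BlockDerivatives

variable {m : Type*} [Fintype m] [DecidableEq m]

/-- Extraction of a submatrix, as a continuous linear map. -/
def submatrixCLM (r c : Fin N → m) : Matrix m m ℂ →L[ℂ] Matrix (Fin N) (Fin N) ℂ :=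
  LinearMap.toContinuousLinearMap
    { toFun := fun B => B.submatrix r c
      map_add' := fun _ _ => rfl
      map_smul' := fun _ _ => rfl }

lemma hasLeftDeriv_submatrix (Y : Matrix m m ℂ) (r c : Fin N → m) :
    HasLeftDeriv Y (fun U => (U : Matrix m m ℂ).submatrix r c)
      (fun U => (Y * (U : Matrix m m ℂ)).submatrix r c) :=
  (hasLeftDeriv_coe Y).clm_comp (submatrixCLM r c)

lemma hasLeftDeriv_conjTranspose_submatrix (Y : Matrix m m ℂ) (r c : Fin N → m) :
    HasLeftDeriv Y (fun U => ((U : Matrix m m ℂ).submatrix r c)ᴴ)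
      (fun U => -((U : Matrix m m ℂ)ᴴ * Y).submatrix c r) :=
  (hasLeftDeriv_star_coe Y).clm_comp (submatrixCLM c r)

end BlockDerivatives

variable (a b : Fin N)

lemma hasLeftDeriv_block : HasLeftDeriv (Matrix.single ((0 : Fin 2), a) ((1 : Fin 2), b) 1)
    block (fun U => Matrix.single a b 1 * lowerBlock U) := by
  refine (hasLeftDeriv_submatrix _ _ _).congr (fun U => rfl) fun U => ?_
  ext i j
  simp [Matrix.mul_apply, Matrix.single_apply, lowerBlock, Fintype.sum_prod_type, Prod.ext_iff]

lemma hasLeftDeriv_conjTranspose_block :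
    HasLeftDeriv (Matrix.single ((0 : Fin 2), a) ((1 : Fin 2), b) 1)
      (fun U => (block U)ᴴ) (fun _ => 0) := by
  refine (hasLeftDeriv_conjTranspose_submatrix _ _ _).congr (fun U => rfl) fun U => ?_
  ext i j
  simp [Matrix.mul_apply]

lemma hasLeftDeriv_conjTranspose_lowerBlock :
    HasLeftDeriv (Matrix.single ((0 : Fin 2), a) ((1 : Fin 2), b) 1)
      (fun U => (lowerBlock U)ᴴ) (fun U => -((block U)ᴴ * Matrix.single a b 1)) := by
  refine (hasLeftDeriv_conjTranspose_submatrix _ _ _).congr (fun U => rfl) fun U => ?_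
  ext i j
  simp [Matrix.mul_apply, Matrix.single_apply, block, Fintype.sum_prod_type, Prod.ext_iff]

lemma hasLeftDeriv_gram :
    HasLeftDeriv (Matrix.single ((0 : Fin 2), a) ((1 : Fin 2), b) 1)
      (fun U => (block U)ᴴ * block U)
      (fun U => (block U)ᴴ * Matrix.single a b 1 * lowerBlock U) := by
  refine ((hasLeftDeriv_conjTranspose_block a b).mul (hasLeftDeriv_block a b)).congr
    (fun U => rfl) fun U => ?_
  simp [mul_assoc]

lemma mul_conjTranspose_pow_succ (B : Matrix (Fin N) (Fin N) ℂ) (k : ℕ) :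
    (B * Bᴴ) ^ (k + 1) = B * (Bᴴ * B) ^ k * Bᴴ := by
  rw [pow_succ', mul_assoc, mul_assoc, ← mul_pow_mul]

lemma hasLeftDeriv_block_mul_gram_pow (k : ℕ) :
    HasLeftDeriv (Matrix.single ((0 : Fin 2), a) ((1 : Fin 2), b) 1)
      (fun U => block U * ((block U)ᴴ * block U) ^ k)
      (fun U => ∑ p ∈ antidiagonal k, (block U * (block U)ᴴ) ^ p.1 * Matrix.single a b 1 *
        (lowerBlock U * ((block U)ᴴ * block U) ^ p.2)) := by
  induction k with
  | zero => simpa using hasLeftDeriv_block a b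
  | succ k ih =>
    refine (ih.mul (hasLeftDeriv_gram a b)).congr (fun U => ?_) fun U => ?_
    · simp only [pow_succ, mul_assoc, Pi.mul_apply]
    · rw [Finset.Nat.sum_antidiagonal_succ', add_comm, mul_conjTranspose_pow_succ _ k]
      simp only [Pi.add_apply, Pi.mul_apply, Finset.sum_mul, pow_succ, pow_zero, mul_one, mul_assoc]

lemma hasLeftDeriv_block_mul_gram_pow_mul_conjTranspose_lowerBlock_apply (k : ℕ) :
    HasLeftDeriv (Matrix.single ((0 : Fin 2), a) ((1 : Fin 2), b) 1)
      (fun U => (block U * ((block U)ᴴ * block U) ^ k * (lowerBlock U)ᴴ) a b)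
      (fun U => ∑ p ∈ antidiagonal k, ((block U * (block U)ᴴ) ^ p.1 * Matrix.single a b 1 *
          (lowerBlock U * ((block U)ᴴ * block U) ^ p.2 * (lowerBlock U)ᴴ) : Matrix _ _ ℂ) a b -
        ((block U * (block U)ᴴ) ^ (k + 1) * Matrix.single a b 1 * 1 : Matrix _ _ ℂ) a b) := by
  refine (((hasLeftDeriv_block_mul_gram_pow a b k).mul
    (hasLeftDeriv_conjTranspose_lowerBlock a b)).clm_comp
      (Matrix.entryLinearMap ℂ ℂ a b).toContinuousLinearMap).congr (fun U => rfl) fun U => ?_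
  rw [mul_conjTranspose_pow_succ _ k]
  simp [Finset.sum_mul, mul_assoc, sub_eq_add_neg, Matrix.sum_apply]

/-- The derivative, along the infinitesimal translation moving the row `b` of `C` into the row `a`
of `A`, of the `(a, b)` entry of `f(λ) A (A†A)^k C†`, where `A`, `C` are the left blocks of `U`. -/
def loopTestDeriv (f : MvPolynomial (Fin N) ℝ) (k : ℕ) (a b : Fin N)
    (U : Matrix.unitaryGroup (Fin 2 × Fin N) ℂ) : ℂ :=
  (spectralGradient (isHermitian_conjTranspose_mul_self (block U)) f * (block U)ᴴ *
      Matrix.single a b 1 * lowerBlock U).trace *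
    (block U * ((block U)ᴴ * block U) ^ k * (lowerBlock U)ᴴ) a b +
  ((f.eval (eigenvalues U) : ℝ) : ℂ) *
    (∑ p ∈ antidiagonal k, ((block U * (block U)ᴴ) ^ p.1 * Matrix.single a b 1 *
      (lowerBlock U * ((block U)ᴴ * block U) ^ p.2 * (lowerBlock U)ᴴ) : Matrix _ _ ℂ) a b -
    ((block U * (block U)ᴴ) ^ (k + 1) * Matrix.single a b 1 * 1 : Matrix _ _ ℂ) a b)

lemma hasLeftDeriv_loopTestDeriv {f : MvPolynomial (Fin N) ℝ} (hf : f.IsSymmetric) (k : ℕ) :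
    HasLeftDeriv (Matrix.single ((0 : Fin 2), a) ((1 : Fin 2), b) 1)
      (fun U => ((f.eval (eigenvalues U) : ℝ) : ℂ) *
        (block U * ((block U)ᴴ * block U) ^ k * (lowerBlock U)ᴴ) a b)
      (loopTestDeriv f k a b) := by
  refine (((hasLeftDeriv_gram a b).eval_eigenvalues
    (fun U => isHermitian_conjTranspose_mul_self (block U)) hf).mul
    (hasLeftDeriv_block_mul_gram_pow_mul_conjTranspose_lowerBlock_apply a b k)).congr
    (fun U => rfl) fun U => ?_
  simp only [Pi.add_apply, Pi.mul_apply, mul_assoc, loopTestDeriv]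
  rfl

lemma trace_gram_pow (U : Matrix.unitaryGroup (Fin 2 × Fin N) ℂ) (k : ℕ) :
    (((block U)ᴴ * block U) ^ k).trace = ((psum (Fin N) ℝ k).eval (eigenvalues U) : ℝ) :=
  trace_pow_eq_eval_psum _ k

lemma trace_lowerBlock_mul_spectralGradient_mul (f : MvPolynomial (Fin N) ℝ) (k : ℕ)
    (U : Matrix.unitaryGroup (Fin 2 × Fin N) ℂ) :
    (lowerBlock U * (spectralGradient (isHermitian_conjTranspose_mul_self (block U)) f *
        (block U)ᴴ) * (block U * ((block U)ᴴ * block U) ^ k * (lowerBlock U)ᴴ)).trace =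
      ((∑ i, MvPolynomial.X i ^ (k + 1) * pderiv i f -
        ∑ i, MvPolynomial.X i ^ (k + 2) * pderiv i f).eval (eigenvalues U) : ℝ) := by
  set H := (block U)ᴴ * block U with hH_def
  set S := spectralGradient (isHermitian_conjTranspose_mul_self (block U)) f with hS_def
  have hassoc : lowerBlock U * (S * (block U)ᴴ) * (block U * H ^ k * (lowerBlock U)ᴴ) =
      lowerBlock U * (S * H ^ (k + 1)) * (lowerBlock U)ᴴ := by
    simp only [hH_def, pow_succ', mul_assoc]
  rw [hassoc, trace_lowerBlock_mul_mul_conjTranspose, mul_assoc, ← hH_def, ← pow_succ, hS_def,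
    trace_spectralGradient_mul_pow, trace_spectralGradient_mul_pow, map_sub, Complex.ofReal_sub]
  rfl

lemma sum_loopTestDeriv (f : MvPolynomial (Fin N) ℝ) (k : ℕ)
    (U : Matrix.unitaryGroup (Fin 2 × Fin N) ℂ) :
    ∑ a, ∑ b, loopTestDeriv f k a b U =
      ((loopOp k f - loopOp (k + 1) f).eval (eigenvalues U) : ℝ) := by
  have hpower (p : ℕ × ℕ) : ((block U * (block U)ᴴ) ^ p.1).trace *
      (lowerBlock U * ((block U)ᴴ * block U) ^ p.2 * (lowerBlock U)ᴴ).trace =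
      ((psum (Fin N) ℝ p.1 * psum (Fin N) ℝ p.2 -
        psum (Fin N) ℝ p.1 * psum (Fin N) ℝ (p.2 + 1)).eval (eigenvalues U) : ℝ) := by
    rw [trace_mul_conjTranspose_pow, trace_lowerBlock_mul_mul_conjTranspose, ← pow_succ]
    simp only [trace_gram_pow]
    push_cast [map_sub, map_mul]
    ring
  have hconst : ((block U * (block U)ᴴ) ^ (k + 1)).trace * (1 : Matrix (Fin N) (Fin N) ℂ).trace =
      ((psum (Fin N) ℝ (k + 1) * psum (Fin N) ℝ 0).eval (eigenvalues U) : ℝ) := by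
    rw [trace_mul_conjTranspose_pow, trace_gram_pow]
    simp [psum]
  have hcomm (g : Fin N → Fin N → ℕ × ℕ → ℂ) : ∑ a, ∑ b, ∑ p ∈ antidiagonal k, g a b p =
      ∑ p ∈ antidiagonal k, ∑ a, ∑ b, g a b p := by
    rw [Finset.sum_congr rfl fun a _ => Finset.sum_comm, Finset.sum_comm]
  simp only [loopTestDeriv, Finset.sum_add_distrib, ← Finset.mul_sum, Finset.sum_sub_distrib,
    hcomm, sum_trace_mul_single_mul_mul_apply, sum_mul_single_mul_apply]
  simp only [trace_lowerBlock_mul_spectralGradient_mul, hpower, hconst, ← Complex.ofReal_sum,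
    ← Complex.ofReal_sub, ← Complex.ofReal_mul, ← Complex.ofReal_add, ← map_sum, ← map_sub,
    ← map_mul, ← map_add]
  congr 2
  simp only [loopOp, Finset.Nat.sum_antidiagonal_succ', Finset.sum_sub_distrib]
  ring

/-- Haar invariance, applied to the matrix valued function `f(λ) A (A†A)^k C†` with `C` the lower
left block, turns into the loop equations once `C†C = 1 - A†A` is inserted. -/
theorem satisfiesLoopEquations_eigenvalueFunctional
    (μ : Measure (Matrix.unitaryGroup (Fin 2 × Fin N) ℂ)) [IsFiniteMeasure μ]
    [μ.IsMulLeftInvariant] : SatisfiesLoopEquations (eigenvalueFunctional μ) := by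
  intro k f hf
  have hderiv (a b : Fin N) := hasLeftDeriv_loopTestDeriv a b hf k
  have hintegrable (a b : Fin N) : Integrable (loopTestDeriv f k a b) μ :=
    (hderiv a b).continuous_deriv.integrable_of_hasCompactSupport
      (HasCompactSupport.of_compactSpace _)
  have hsum : ∫ U, ∑ a, ∑ b, loopTestDeriv f k a b U ∂μ = 0 := by
    rw [integral_finsetSum _ fun a _ => integrable_finsetSum _ fun b _ => hintegrable a b]
    refine Finset.sum_eq_zero fun a _ => ?_
    rw [integral_finsetSum _ fun b _ => hintegrable a b]
    exact Finset.sum_eq_zero fun b _ => (hderiv a b).integral_eq_zero μ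
  simp only [sum_loopTestDeriv] at hsum
  have hreal : eigenvalueFunctional μ (loopOp k f - loopOp (k + 1) f) = 0 :=
    Complex.ofReal_eq_zero.1 (integral_ofReal.symm.trans hsum)
  rwa [map_sub, sub_eq_zero] at hreal

end HaarLoopEquations

section Legendre

lemma degreeLT_le_span_range {R : Type*} [Ring R] {n : ℕ} {C : Fin n → R[X]}
    (hmonic : ∀ i, (C i).Monic) (hdeg : ∀ i, (C i).natDegree = i) :
    degreeLT R n ≤ Submodule.span R (Set.range C) := by
  induction n with
  | zero => intro v hv; simp_all [mem_degreeLT, Nat.WithBot.lt_zero_iff]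
  | succ n ih =>
    intro v hv
    have hlast : (C (Fin.last n)).coeff n = 1 := by
      simpa [Monic, leadingCoeff, hdeg] using hmonic (Fin.last n)
    have hlt : v - v.coeff n • C (Fin.last n) ∈ degreeLT R n := by
      rw [mem_degreeLT, degree_lt_iff_coeff_zero] at hv ⊢
      intro k hk
      rw [coeff_sub, coeff_smul, smul_eq_mul]
      obtain rfl | hk := hk.eq_or_lt
      · rw [hlast, mul_one, sub_self]
      · rw [hv k hk, coeff_eq_zero_of_natDegree_lt (p := C _) (by rwa [hdeg]),
          mul_zero, sub_zero]
    rw [← sub_add_cancel v (v.coeff n • C (Fin.last n))]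
    refine add_mem (Submodule.span_mono ?_ (ih (C := C ∘ Fin.castSucc) (fun i => hmonic _)
      (fun i => by simp [hdeg]) hlt)) (Submodule.smul_mem _ _ (Submodule.subset_span ⟨_, rfl⟩))
    exact Set.range_comp_subset_range _ _

/-- Integration of polynomials over the unit interval. -/
def unitIntegral : ℝ[X] →ₗ[ℝ] ℝ where
  toFun p := ∫ x in (0 : ℝ)..1, p.eval x
  map_add' p q := by
    simpa using intervalIntegral.integral_add (p.continuous.intervalIntegrable _ _)
      (q.continuous.intervalIntegrable _ _)
  map_smul' c p := by simp

lemma unitIntegral_apply (p : ℝ[X]) : unitIntegral p = ∫ x in (0 : ℝ)..1, p.eval x := rfl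

lemma unitIntegral_derivative (p : ℝ[X]) :
    unitIntegral (derivative p) = p.eval 1 - p.eval 0 :=
  intervalIntegral.integral_eq_sub_of_hasDerivAt (fun x _ => p.hasDerivAt x)
    ((derivative p).continuous.intervalIntegrable _ _)

lemma eq_zero_of_unitIntegral_mul_self_eq_zero {p : ℝ[X]} (h : unitIntegral (p * p) = 0) :
    p = 0 := by
  by_contra hp
  obtain ⟨c, hc, hroot⟩ : ∃ c ∈ Set.Icc (0 : ℝ) 1, ¬ p.IsRoot c := by
    by_contra! hall
    exact hp (eq_zero_of_infinite_isRoot p ((Set.Icc_infinite zero_lt_one).mono hall))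
  refine h.not_gt (intervalIntegral.integral_pos zero_lt_one (p * p).continuous.continuousOn
    (fun x _ => ?_) ⟨c, hc, ?_⟩)
  · simpa using mul_self_nonneg (p.eval x)
  · simpa using hroot

lemma unitIntegral_iterate_derivative_mul {n : ℕ} {f : ℝ[X]} (g : ℝ[X])
    (h₀ : ∀ j < n, (derivative^[j] f).eval 0 = 0) (h₁ : ∀ j < n, (derivative^[j] f).eval 1 = 0) :
    unitIntegral (derivative^[n] f * g) = (-1) ^ n * unitIntegral (f * derivative^[n] g) := by
  induction n generalizing g with
  | zero => simp
  | succ n ih =>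
    have hparts := unitIntegral_derivative (derivative^[n] f * g)
    rw [derivative_mul, map_add, eval_mul, eval_mul, h₀ n n.lt_succ_self, h₁ n n.lt_succ_self,
      ← Function.iterate_succ_apply' derivative, ih (derivative g) (fun j hj => h₀ j (by omega))
        (fun j hj => h₁ j (by omega)), ← Function.iterate_succ_apply derivative] at hparts
    linear_combination hparts

lemma eval_iterate_derivative_pow_eq_zero {R : Type*} [CommRing R] {p : R[X]} {x : R}
    (hx : p.eval x = 0) {n j : ℕ} (hj : j < n) : (derivative^[j] (p ^ n)).eval x = 0 := by
  obtain ⟨r, hr⟩ := pow_sub_dvd_iterate_derivative_pow p n j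
  rw [hr, eval_mul, eval_pow, hx, zero_pow (Nat.sub_ne_zero_of_lt hj), zero_mul]

/-- The shifted Legendre polynomial `(-1)ⁿ Pₙ(2x - 1)`, normalized in `L²[0, 1]`. -/
def normalizedLegendre (n : ℕ) : ℝ[X] :=
  √(2 * n + 1) • (shiftedLegendre n).map (Int.castRingHom ℝ)

lemma factorial_smul_map_shiftedLegendre (n : ℕ) :
    (n ! : ℝ) • (shiftedLegendre n).map (Int.castRingHom ℝ) =
      derivative^[n] ((X * (1 - X)) ^ n) := by
  have h := congrArg (Polynomial.map (Int.castRingHom ℝ)) (factorial_mul_shiftedLegendre_eq n)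
  rw [← iterate_derivative_map] at h
  simpa [mul_pow, smul_eq_C_mul] using h

lemma iterate_derivative_comp_C_mul_X_sub_one {R : Type*} [CommRing R] (p : R[X]) (a : R) (n : ℕ) :
    derivative^[n] (p.comp (C a * X - 1)) = a ^ n • (derivative^[n] p).comp (C a * X - 1) := by
  induction n with
  | zero => simp
  | succ n ih =>
    simp only [Function.iterate_succ_apply', ih, derivative_comp, derivative_sub,
      derivative_C_mul, derivative_X, derivative_one, sub_zero, mul_one, smul_eq_C_mul, pow_succ,
      map_mul, mul_assoc]

lemma legendre_comp_two_mul_X_sub_one (n : ℕ) :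
    (legendre n).comp (C 2 * X - 1) =
      (-1 : ℝ) ^ n • (shiftedLegendre n).map (Int.castRingHom ℝ) := by
  have hcomp : ((X ^ 2 - 1 : ℝ[X]) ^ n).comp (C 2 * X - 1) =
      ((-1) ^ n * 2 ^ n * 2 ^ n : ℝ) • (X * (1 - X)) ^ n := by
    simp only [pow_comp, sub_comp, X_comp, one_comp, smul_eq_C_mul, map_mul, map_pow, map_neg,
      map_one, map_ofNat, ← mul_pow]
    ring
  have h := iterate_derivative_comp_C_mul_X_sub_one ((X ^ 2 - 1 : ℝ[X]) ^ n) 2 n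
  rw [hcomp, iterate_derivative_smul, ← factorial_smul_map_shiftedLegendre, smul_smul] at h
  refine smul_right_injective ℝ[X] (pow_ne_zero n (two_ne_zero (α := ℝ))) ?_
  dsimp only
  rw [legendre, mul_comp, C_comp, ← smul_eq_C_mul, smul_comm, ← h, smul_smul, smul_smul]
  congr 1
  field_simp

lemma eval_normalizedLegendre (n : ℕ) (x : ℝ) :
    (normalizedLegendre n).eval x =
      √(2 * n + 1) * ((-1) ^ n * (legendre n).eval (2 * x - 1)) := by
  have h := congrArg (eval x) (legendre_comp_two_mul_X_sub_one n)
  simp only [eval_comp, eval_sub, eval_mul, eval_C, eval_X, eval_one, eval_smul, smul_eq_mul] at h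
  rw [normalizedLegendre, eval_smul, smul_eq_mul, h, ← mul_assoc ((-1) ^ n), ← mul_pow]
  simp

lemma degree_normalizedLegendre (n : ℕ) : (normalizedLegendre n).degree = n := by
  rw [normalizedLegendre, degree_smul_of_smul_regular _
    (IsSMulRegular.of_ne_zero (by positivity)), degree_map_eq_of_injective
    (RingHom.injective_int _), degree_shiftedLegendre]

lemma unitIntegral_map_shiftedLegendre_mul {n : ℕ} {v : ℝ[X]} (hv : v.degree < n) :
    unitIntegral ((shiftedLegendre n).map (Int.castRingHom ℝ) * v) = 0 := by
  have h : (n ! : ℝ) • unitIntegral ((shiftedLegendre n).map (Int.castRingHom ℝ) * v) = 0 := by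
    rw [← map_smul, ← smul_mul_assoc, factorial_smul_map_shiftedLegendre,
      unitIntegral_iterate_derivative_mul v
        (fun j hj => eval_iterate_derivative_pow_eq_zero (by simp) hj)
        (fun j hj => eval_iterate_derivative_pow_eq_zero (by simp) hj),
      iterate_derivative_eq_zero_of_degree_lt hv, mul_zero, map_zero, mul_zero]
  exact (smul_eq_zero_iff_right (by positivity)).1 h

lemma degree_X_sub_one_mul_derivative_sub_lt {R : Type*} [CommRing R] {n : ℕ} {p : R[X]}
    (hp : p.natDegree ≤ n) : ((X - 1) * derivative p - (n : R) • p).degree < (n : WithBot ℕ) := by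
  rw [degree_lt_iff_coeff_zero]
  intro k hk
  have hX : (X * derivative p).coeff k = k * p.coeff k := by
    cases k with
    | zero => simp
    | succ k => rw [coeff_X_mul, coeff_derivative]; push_cast; ring
  rw [sub_mul, one_mul, coeff_sub, coeff_sub, hX, coeff_derivative, coeff_smul, smul_eq_mul,
    coeff_eq_zero_of_natDegree_lt (by omega : p.natDegree < k + 1), zero_mul, sub_zero]
  obtain rfl | hk := hk.eq_or_lt
  · rw [sub_self]
  · rw [coeff_eq_zero_of_natDegree_lt (by omega : p.natDegree < k), mul_zero, mul_zero, sub_zero]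

lemma unitIntegral_map_shiftedLegendre_mul_self (n : ℕ) :
    unitIntegral ((shiftedLegendre n).map (Int.castRingHom ℝ) *
      (shiftedLegendre n).map (Int.castRingHom ℝ)) = (2 * n + 1 : ℝ)⁻¹ := by
  set s := (shiftedLegendre n).map (Int.castRingHom ℝ) with hs
  have hderiv : derivative ((X - 1) * (s * s)) = (2 * n + 1 : ℝ) • (s * s) +
      (2 : ℝ) • (s * ((X - 1) * derivative s - (n : ℝ) • s)) := by
    simp only [derivative_mul, derivative_sub, derivative_X, derivative_one, smul_eq_C_mul,
      map_add, map_mul, map_one, map_ofNat]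
    ring
  have hdeg : s.natDegree ≤ n := natDegree_map_le.trans (natDegree_shiftedLegendre n).le
  have hzero : s.eval 0 = 1 := by simp [hs, ← coeff_zero_eq_eval_zero, coeff_shiftedLegendre]
  have hint := unitIntegral_derivative ((X - 1) * (s * s))
  rw [hderiv, map_add, map_smul, map_smul,
    unitIntegral_map_shiftedLegendre_mul (degree_X_sub_one_mul_derivative_sub_lt hdeg)] at hint
  refine eq_inv_of_mul_eq_one_right ?_
  simpa [hzero] using hint

lemma unitIntegral_normalizedLegendre_mul (i j : ℕ) :
    unitIntegral (normalizedLegendre i * normalizedLegendre j) = if i = j then 1 else 0 := by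
  wlog hij : j ≤ i generalizing i j
  · rw [mul_comm, this j i (by omega)]
    simp only [eq_comm]
  obtain rfl | hij := hij.eq_or_lt
  · have hsqrt := Real.mul_self_sqrt (by positivity : (0 : ℝ) ≤ 2 * j + 1)
    rw [if_pos rfl, normalizedLegendre, smul_mul_smul_comm, hsqrt, map_smul,
      unitIntegral_map_shiftedLegendre_mul_self, smul_eq_mul, mul_inv_cancel₀ (by positivity)]
  · rw [if_neg hij.ne', normalizedLegendre, smul_mul_assoc, map_smul,
      unitIntegral_map_shiftedLegendre_mul, smul_zero]
    rw [degree_normalizedLegendre]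
    exact_mod_cast hij

lemma legendreKernel_eq_sum (N : ℕ) (x y : ℝ) : legendreKernel N x y =
    ∑ i : Fin N, (normalizedLegendre i).eval x * (normalizedLegendre i).eval y := by
  rw [legendreKernel, Finset.sum_range]
  refine Finset.sum_congr rfl fun i _ => ?_
  have hsqrt := Real.mul_self_sqrt (by positivity : (0 : ℝ) ≤ 2 * (i : ℝ) + 1)
  have hsign : (-1 : ℝ) ^ (i : ℕ) * (-1) ^ (i : ℕ) = 1 := by rw [← mul_pow]; simp
  rw [eval_normalizedLegendre, eval_normalizedLegendre]
  linear_combination (legendre i).eval (2 * x - 1) * (legendre i).eval (2 * y - 1) *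
    (-hsqrt - √(2 * i + 1) * √(2 * i + 1) * hsign)

lemma weight_two (N : ℕ) (x : ℝ) : weight N 2 x = 1 := by simp [weight]

lemma weightedInner_weight_two (N : ℕ) (f g : ℝ[X]) :
    weightedInner (weight N 2) f g = unitIntegral (f * g) := by
  simp [weightedInner, weight_two, unitIntegral_apply]

lemma IsMonicOrthogonal.unitIntegral_mul_eq_zero {N : ℕ} {C : Fin N → ℝ[X]}
    (hC : IsMonicOrthogonal (weight N 2) C) (i : Fin N) {v : ℝ[X]} (hv : v.degree < (i : ℕ)) :
    unitIntegral (C i * v) = 0 := by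
  have hspan := degreeLT_le_span_range (C := fun j : Fin i => C (Fin.castLE i.2.le j))
    (fun j => hC.monic _) (fun j => hC.natDegree_eq _)
  refine (hspan.trans (Submodule.span_le (p := (unitIntegral ∘ₗ LinearMap.mulLeft ℝ (C i)).ker).2
    ?_)) (mem_degreeLT.2 hv)
  rintro _ ⟨j, rfl⟩
  have hne : i ≠ Fin.castLE i.2.le j := Fin.ne_of_gt j.2
  simpa [weightedInner_weight_two] using hC.orthogonal i _ hne

/-- `v = Cᵢ - Dᵢ` has degree less than `i`, so it is orthogonal to `Cᵢ` and `Dᵢ`, hence to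
itself. -/
theorem IsMonicOrthogonal.unique {N : ℕ} {C D : Fin N → ℝ[X]}
    (hC : IsMonicOrthogonal (weight N 2) C) (hD : IsMonicOrthogonal (weight N 2) D) : C = D := by
  funext i
  have hdeg : (C i - D i).degree < (i : ℕ) := by
    have hlt := degree_sub_lt_left (p := C i) (q := D i)
      (by rw [degree_eq_natDegree (hC.monic i).ne_zero, degree_eq_natDegree (hD.monic i).ne_zero,
        hC.natDegree_eq, hD.natDegree_eq])
      (hC.monic i).ne_zero (by rw [(hC.monic i).leadingCoeff, (hD.monic i).leadingCoeff])
    rwa [degree_eq_natDegree (hC.monic i).ne_zero, hC.natDegree_eq] at hlt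
  refine sub_eq_zero.1 (eq_zero_of_unitIntegral_mul_self_eq_zero ?_)
  rw [sub_mul, map_sub, hC.unitIntegral_mul_eq_zero i hdeg, hD.unitIntegral_mul_eq_zero i hdeg,
    sub_zero]

/-- The monic Legendre polynomial on `[0, 1]`. -/
def monicLegendre (n : ℕ) : ℝ[X] :=
  (normalizedLegendre n).leadingCoeff⁻¹ • normalizedLegendre n

lemma normalizedLegendre_ne_zero (n : ℕ) : normalizedLegendre n ≠ 0 :=
  degree_ne_bot.1 (by simp [degree_normalizedLegendre])

lemma unitIntegral_monicLegendre_mul (i j : ℕ) :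
    unitIntegral (monicLegendre i * monicLegendre j) =
      if i = j then ((normalizedLegendre i).leadingCoeff ^ 2)⁻¹ else 0 := by
  rw [monicLegendre, monicLegendre, smul_mul_smul_comm, map_smul,
    unitIntegral_normalizedLegendre_mul]
  split_ifs with hij
  · rw [hij, smul_eq_mul, mul_one, ← mul_inv, ← sq]
  · exact smul_zero _

lemma isMonicOrthogonal_monicLegendre (N : ℕ) :
    IsMonicOrthogonal (weight N 2) fun i : Fin N => monicLegendre i where
  monic i := by
    rw [monicLegendre, smul_eq_C_mul, mul_comm]
    exact monic_mul_leadingCoeff_inv (normalizedLegendre_ne_zero i)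
  natDegree_eq i := by
    have hlead := leadingCoeff_ne_zero.2 (normalizedLegendre_ne_zero i)
    rw [monicLegendre, natDegree_smul _ (inv_ne_zero hlead),
      natDegree_eq_of_degree_eq_some (degree_normalizedLegendre i)]
  orthogonal i j hij := by
    rw [weightedInner_weight_two, unitIntegral_monicLegendre_mul, if_neg (Fin.val_injective.ne hij)]

theorem kernel_eq_legendreKernel {N : ℕ} {C : Fin N → ℝ[X]}
    (hC : IsMonicOrthogonal (weight N 2) C) (x y : ℝ) :
    kernel (weight N 2) C x y = legendreKernel N x y := by
  rw [hC.unique (isMonicOrthogonal_monicLegendre N), legendreKernel_eq_sum, kernel, weight_two,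
    one_mul]
  refine Finset.sum_congr rfl fun i _ => ?_
  have hlead := leadingCoeff_ne_zero.2 (normalizedLegendre_ne_zero i)
  rw [weightedInner_weight_two, unitIntegral_monicLegendre_mul, if_pos rfl, monicLegendre,
    eval_smul, eval_smul, smul_eq_mul, smul_eq_mul]
  field_simp

end Legendre

section BorderedDeterminant

open Matrix

variable {n R : Type*} [Fintype n] [DecidableEq n] [CommRing R]

lemma det_pow_mul_det_fromBlocks (M : Matrix n n R) (b c : n → R) (d : R) :
    M.det ^ Fintype.card n * (fromBlocks M (replicateCol (Fin 1) b) (replicateRow (Fin 1) c)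
      (of fun _ _ => d)).det =
    M.det ^ Fintype.card n * (d * M.det - c ⬝ᵥ M.adjugate *ᵥ b) := by
  have hmul : fromBlocks M (replicateCol (Fin 1) b) (replicateRow (Fin 1) c) (of fun _ _ => d) *
      fromBlocks M.adjugate (-replicateCol (Fin 1) (M.adjugate *ᵥ b)) 0 (of fun _ _ => M.det) =
      fromBlocks (M.det • 1) 0 (replicateRow (Fin 1) c * M.adjugate)
        (of fun _ _ => d * M.det - c ⬝ᵥ M.adjugate *ᵥ b) := by
    rw [fromBlocks_multiply, mul_adjugate, Matrix.mul_zero, Matrix.mul_zero, add_zero, add_zero]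
    congr 1
    · rw [replicateCol_mulVec, Matrix.mul_neg, ← Matrix.mul_assoc, mul_adjugate]
      ext i j
      simp [Matrix.mul_apply, mul_comm]
    · ext i j
      simp [Matrix.mul_apply, dotProduct]
      ring
  have hdet := congrArg det hmul
  have hadj : M.det * M.adjugate.det = M.det ^ Fintype.card n := by
    rw [← det_mul, mul_adjugate, det_smul, det_one, mul_one]
  rw [det_mul, det_fromBlocks_zero₂₁, det_fromBlocks_zero₁₂, det_fin_one, det_fin_one, det_smul,
    det_one, mul_one] at hdet
  simp only [of_apply] at hdet
  rwa [mul_comm M.adjugate.det, hadj, mul_comm] at hdet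

/-- Both sides are polynomial in `M`, so one may replace `M` by `M + X`, whose determinant is
monic. -/
lemma det_fromBlocks_border (M : Matrix n n R) (b c : n → R) (d : R) :
    (fromBlocks M (replicateCol (Fin 1) b) (replicateRow (Fin 1) c) (of fun _ _ => d)).det =
      d * M.det - c ⬝ᵥ M.adjugate *ᵥ b := by
  have hreg : IsLeftRegular ((charmatrix (-M)).det ^ Fintype.card n) :=
    (((charpoly_monic (-M)).pow _).isRegular).left
  have h := hreg (det_pow_mul_det_fromBlocks (charmatrix (-M)) (C ∘ b) (C ∘ c) (C d))
  have heval : (charmatrix (-M)).map (evalRingHom 0) = M := by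
    ext i j
    by_cases hij : i = j <;> simp [hij]
  have heval_vec (v : n → R) : ⇑(evalRingHom (0 : R)) ∘ (C ∘ v) = v := by
    ext; simp
  have hadj : ⇑(evalRingHom (0 : R)) ∘ ((charmatrix (-M)).adjugate *ᵥ (C ∘ b)) =
      M.adjugate *ᵥ b := by
    ext i
    rw [Function.comp_apply, RingHom.map_mulVec, heval_vec, ← RingHom.mapMatrix_apply,
      RingHom.map_adjugate, RingHom.mapMatrix_apply, heval]
  have hblocks : (fromBlocks (charmatrix (-M)) (replicateCol (Fin 1) (C ∘ b))
      (replicateRow (Fin 1) (C ∘ c)) (of fun _ _ => C d)).map (evalRingHom (0 : R)) =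
      fromBlocks M (replicateCol (Fin 1) b) (replicateRow (Fin 1) c) (of fun _ _ => d) := by
    rw [fromBlocks_map, heval]
    congr 1 <;> ext <;> simp
  replace h := congrArg (evalRingHom 0) h
  rw [map_sub, map_mul, RingHom.map_det, RingHom.map_det, RingHom.map_dotProduct,
    RingHom.mapMatrix_apply, RingHom.mapMatrix_apply, heval, heval_vec, hadj, hblocks] at h
  simpa using h

end BorderedDeterminant

section Gaudin

open Matrix

lemma det_kernel_snoc {α : Type*} (K : α → α → ℝ) {ℓ : ℕ} (x : Fin ℓ → α) (y : α) :
    (of fun j k => K ((Fin.snoc x y : Fin (ℓ + 1) → α) j)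
      ((Fin.snoc x y : Fin (ℓ + 1) → α) k)).det =
    K y y * (of fun j k => K (x j) (x k)).det -
      ∑ i, ∑ j, (of fun j k => K (x j) (x k)).adjugate i j * (K (x j) y * K y (x i)) := by
  rw [← det_submatrix_equiv_self (finSumFinEquiv (m := ℓ) (n := 1))]
  have hblocks : (of fun j k => K ((Fin.snoc x y : Fin (ℓ + 1) → α) j)
      ((Fin.snoc x y : Fin (ℓ + 1) → α) k)).submatrix finSumFinEquiv finSumFinEquiv =
      fromBlocks (of fun j k => K (x j) (x k)) (replicateCol (Fin 1) fun j => K (x j) y)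
        (replicateRow (Fin 1) fun k => K y (x k)) (of fun _ _ => K y y) := by
    have hleft (i : Fin ℓ) : (Fin.snoc x y : Fin (ℓ + 1) → α) (Fin.castAdd 1 i) = x i :=
      Fin.snoc_castSucc (α := fun _ => α) y x i
    have hright (i : Fin 1) : (Fin.snoc x y : Fin (ℓ + 1) → α) (Fin.natAdd ℓ i) = y := by
      rw [Subsingleton.elim i 0]
      exact Fin.snoc_last (α := fun _ => α) y x
    ext (i | i) (j | j) <;> simp [hleft, hright]
  rw [hblocks, det_fromBlocks_border]
  simp only [dotProduct, mulVec, Finset.mul_sum]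
  congr! 3
  ring

theorem integral_det_kernel_snoc {α : Type*} [MeasurableSpace α] {ν : Measure α} {K : α → α → ℝ}
    (hdiag : Integrable (fun y => K y y) ν)
    (hprod : ∀ x z, Integrable (fun y => K x y * K y z) ν)
    (hrep : ∀ x z, ∫ y, K x y * K y z ∂ν = K x z) {ℓ : ℕ} (x : Fin ℓ → α) :
    ∫ y, (of fun j k => K ((Fin.snoc x y : Fin (ℓ + 1) → α) j)
      ((Fin.snoc x y : Fin (ℓ + 1) → α) k)).det ∂ν =
    (∫ y, K y y ∂ν - ℓ) * (of fun j k => K (x j) (x k)).det := by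
  set A : Matrix (Fin ℓ) (Fin ℓ) ℝ := of fun j k => K (x j) (x k) with hA
  have hterm (i j : Fin ℓ) :
      Integrable (fun y => A.adjugate i j * (K (x j) y * K y (x i))) ν := (hprod _ _).const_mul _
  simp only [det_kernel_snoc, ← hA]
  rw [integral_sub (hdiag.mul_const _) (integrable_finsetSum _ fun i _ =>
      integrable_finsetSum _ fun j _ => hterm i j), integral_mul_const,
    integral_finsetSum _ fun i _ => integrable_finsetSum _ fun j _ => hterm i j]
  have htrace (i : Fin ℓ) : ∫ y, ∑ j, A.adjugate i j * (K (x j) y * K y (x i)) ∂ν = A.det := by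
    rw [integral_finsetSum _ fun j _ => hterm i j]
    simp only [integral_const_mul, hrep]
    have := congrFun₂ (adjugate_mul A) i i
    rwa [Matrix.mul_apply, Matrix.smul_apply, one_apply_eq, smul_eq_mul, mul_one] at this
  simp only [htrace, Finset.sum_const, Finset.card_univ, Fintype.card_fin, nsmul_eq_mul]
  ring

end Gaudin

section MarginalDensity

variable {α : Type*} [MeasurableSpace α] (ν : Measure α) [SigmaFinite ν]

lemma map_castSucc_withDensity_pi {n : ℕ} {f : (Fin (n + 1) → α) → ℝ≥0∞} (hf : Measurable f) :
    ((Measure.pi fun _ => ν).withDensity f).map (fun x i => x (Fin.castSucc i)) =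
      (Measure.pi fun _ => ν).withDensity
        fun x => ∫⁻ y, f (Fin.snoc x y : Fin (n + 1) → α) ∂ν := by
  have hinit : Measurable fun (x : Fin (n + 1) → α) (i : Fin n) => x (Fin.castSucc i) := by
    fun_prop
  have hsplit := (measurePreserving_piFinSuccAbove (fun _ : Fin (n + 1) => ν) (Fin.last n)).symm
  have hsymm (p : α × (Fin n → α)) : (MeasurableEquiv.piFinSuccAbove (fun _ : Fin (n + 1) => α)
      (Fin.last n)).symm p = (Fin.snoc p.2 p.1 : Fin (n + 1) → α) := by
    simp [MeasurableEquiv.piFinSuccAbove, Fin.snocEquiv]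
  ext s hs
  have hind := hf.indicator (hinit hs)
  have hind_symm : Measurable fun p : α × (Fin n → α) =>
      ((fun x i => x (Fin.castSucc i)) ⁻¹' s).indicator f
        ((MeasurableEquiv.piFinSuccAbove (fun _ : Fin (n + 1) => α) (Fin.last n)).symm p) :=
    hind.comp hsplit.measurable
  rw [Measure.map_apply hinit hs, withDensity_apply _ (hinit hs), withDensity_apply _ hs,
    ← lintegral_indicator (hinit hs), ← lintegral_indicator hs, ← hsplit.lintegral_comp hind,
    lintegral_prod_symm _ hind_symm.aemeasurable]
  refine lintegral_congr fun z => ?_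
  simp only [hsymm]
  by_cases hz : z ∈ s <;> simp [Set.indicator, hz]

end MarginalDensity

section DeterminantalMeasure

open Matrix

lemma legendreKernel_eq_eval (N : ℕ) (x y : ℝ) : legendreKernel N x y =
    (∑ i : Fin N, (normalizedLegendre i).eval x • normalizedLegendre i).eval y := by
  simp [legendreKernel_eq_sum, eval_finsetSum]

lemma legendreKernel_comm (N : ℕ) (x y : ℝ) : legendreKernel N x y = legendreKernel N y x := by
  simp only [legendreKernel_eq_sum, mul_comm]

lemma continuous_legendreKernel (N : ℕ) :
    Continuous fun p : ℝ × ℝ => legendreKernel N p.1 p.2 := by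
  simp only [legendreKernel_eq_sum]
  fun_prop

lemma setIntegral_eval (p : ℝ[X]) : ∫ y in Set.Icc (0 : ℝ) 1, p.eval y = unitIntegral p := by
  rw [unitIntegral_apply, intervalIntegral.integral_of_le zero_le_one, integral_Icc_eq_integral_Ioc]

lemma setIntegral_legendreKernel_self (N : ℕ) :
    ∫ y in Set.Icc (0 : ℝ) 1, legendreKernel N y y = N := by
  have heval (y : ℝ) : legendreKernel N y y =
      (∑ i : Fin N, normalizedLegendre i * normalizedLegendre i).eval y := by
    simp [legendreKernel_eq_sum, eval_finsetSum]
  simp [heval, setIntegral_eval, unitIntegral_normalizedLegendre_mul]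

lemma setIntegral_legendreKernel_mul_legendreKernel (N : ℕ) (x z : ℝ) :
    ∫ y in Set.Icc (0 : ℝ) 1, legendreKernel N x y * legendreKernel N y z =
      legendreKernel N x z := by
  simp_rw [legendreKernel_comm N _ z, legendreKernel_eq_eval N x, legendreKernel_eq_eval N z,
    ← eval_mul, setIntegral_eval, Finset.sum_mul_sum, smul_mul_smul_comm, map_sum, map_smul,
    unitIntegral_normalizedLegendre_mul, Fin.val_inj]
  simp [eval_finsetSum, mul_comm]

lemma determinantalDensity_nonneg (N : ℕ) {ℓ : ℕ} (x : Fin ℓ → ℝ) :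
    0 ≤ determinantalDensity N (legendreKernel N) x := by
  let B : Matrix (Fin ℓ) (Fin N) ℝ := of fun j i => (normalizedLegendre i).eval (x j)
  have hgram : (of fun j k => legendreKernel N (x j) (x k)) = B * Bᴴ := by
    ext j k
    simp [B, Matrix.mul_apply, legendreKernel_eq_sum]
  rw [determinantalDensity, hgram]
  exact mul_nonneg (by positivity) (posSemidef_self_mul_conjTranspose B).det_nonneg

lemma continuous_determinantalDensity (N ℓ : ℕ) :
    Continuous fun x : Fin ℓ → ℝ => determinantalDensity N (legendreKernel N) x := by
  refine continuous_const.mul (Continuous.matrix_det (continuous_matrix fun j k => ?_))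
  exact (continuous_legendreKernel N).comp
    (f := fun x : Fin ℓ → ℝ => (x j, x k)) (by fun_prop)

lemma integral_determinantalDensity_snoc {N ℓ : ℕ} (hℓ : ℓ + 1 ≤ N) (x : Fin ℓ → ℝ) :
    ∫ y in Set.Icc (0 : ℝ) 1, determinantalDensity N (legendreKernel N)
      (Fin.snoc x y : Fin (ℓ + 1) → ℝ) = determinantalDensity N (legendreKernel N) x := by
  have hcont (y : ℝ) := (continuous_legendreKernel N).comp (Continuous.prodMk_right y)
  have hcont_diag := (continuous_legendreKernel N).comp (continuous_id.prodMk continuous_id)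
  have hgaudin := integral_det_kernel_snoc (ν := volume.restrict (Set.Icc (0 : ℝ) 1))
    (K := legendreKernel N) hcont_diag.continuousOn.integrableOn_Icc
    (fun x z => by
      simp_rw [legendreKernel_comm N _ z]
      exact ((hcont x).mul (hcont z)).continuousOn.integrableOn_Icc)
    (setIntegral_legendreKernel_mul_legendreKernel N) x
  simp only [determinantalDensity, integral_const_mul, hgaudin, setIntegral_legendreKernel_self]
  obtain ⟨k, rfl⟩ := Nat.exists_eq_add_of_le hℓ
  rw [show ℓ + 1 + k - (ℓ + 1) = k by omega, show ℓ + 1 + k - ℓ = k + 1 by omega,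
    Nat.factorial_succ]
  push_cast
  ring

/-- The measure on `[0,1]^ℓ` whose density is the determinantal `ℓ`-point function of the Legendre
kernel. -/
def determinantalMeasure (N ℓ : ℕ) : Measure (Fin ℓ → ℝ) :=
  (volume.restrict (Set.Icc (0 : Fin ℓ → ℝ) 1)).withDensity fun x =>
    ENNReal.ofReal (determinantalDensity N (legendreKernel N) x)

lemma measurable_ofReal_determinantalDensity (N ℓ : ℕ) : Measurable fun x : Fin ℓ → ℝ =>
    ENNReal.ofReal (determinantalDensity N (legendreKernel N) x) :=
  (continuous_determinantalDensity N ℓ).measurable.ennreal_ofReal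

lemma map_castSucc_determinantalMeasure {N ℓ : ℕ} (hℓ : ℓ + 1 ≤ N) :
    (determinantalMeasure N (ℓ + 1)).map (fun x i => x (Fin.castSucc i)) =
      determinantalMeasure N ℓ := by
  have hcont (x : Fin ℓ → ℝ) : Continuous fun y : ℝ =>
      determinantalDensity N (legendreKernel N) (Fin.snoc x y : Fin (ℓ + 1) → ℝ) :=
    (continuous_determinantalDensity N (ℓ + 1)).comp
      (f := fun y => (Fin.snoc x y : Fin (ℓ + 1) → ℝ)) (by fun_prop)
  rw [determinantalMeasure, determinantalMeasure, volume_restrict_Icc_eq_pi,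
    volume_restrict_Icc_eq_pi,
    map_castSucc_withDensity_pi _ (measurable_ofReal_determinantalDensity N (ℓ + 1))]
  congr 1 with x
  rw [← ofReal_integral_eq_lintegral_ofReal (hcont x).continuousOn.integrableOn_Icc
    (ae_of_all _ fun y => determinantalDensity_nonneg N _), integral_determinantalDensity_snoc hℓ]

lemma map_castLE_determinantalMeasure {N ℓ : ℕ} (hℓ : ℓ ≤ N) :
    (determinantalMeasure N N).map (fun x i => x (Fin.castLE hℓ i)) =
      determinantalMeasure N ℓ := by
  induction hℓ using Nat.decreasingInduction with
  | self => exact Measure.map_id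
  | of_succ ℓ hℓ ih =>
    rw [← map_castSucc_determinantalMeasure hℓ, ← ih,
      Measure.map_map (by fun_prop) (by fun_prop)]
    rfl

lemma isProbabilityMeasure_determinantalMeasure (N : ℕ) :
    IsProbabilityMeasure (determinantalMeasure N N) := by
  have hempty : determinantalMeasure N 0 Set.univ = 1 := by
    have hfactorial : (N ! : ℝ) ≠ 0 := by exact_mod_cast Nat.factorial_ne_zero N
    rw [determinantalMeasure, volume_restrict_Icc_eq_pi]
    simp [determinantalDensity, hfactorial]
  constructor
  rwa [← map_castLE_determinantalMeasure (Nat.zero_le N), Measure.map_apply (by fun_prop)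
    MeasurableSet.univ, Set.preimage_univ] at hempty

end DeterminantalMeasure

section MomentProblem

variable {σ : Type*} {s : Set (σ → ℝ)}

lemma exists_mvPolynomial_near_of_isCompact (hs : IsCompact s) (g : C(σ → ℝ, ℝ)) {ε : ℝ}
    (hε : 0 < ε) : ∃ f : MvPolynomial σ ℝ, ∀ x ∈ s, ‖f.eval x - g x‖ < ε := by
  let toContinuousMap : MvPolynomial σ ℝ →ₐ[ℝ] C(σ → ℝ, ℝ) :=
    MvPolynomial.aeval fun i => ⟨fun x => x i, continuous_apply i⟩
  have happly (f : MvPolynomial σ ℝ) (x : σ → ℝ) : toContinuousMap f x = f.eval x := by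
    have hcomp : (ContinuousMap.evalAlgHom ℝ ℝ x).comp toContinuousMap = MvPolynomial.aeval x := by
      ext i
      simp [toContinuousMap]
    exact DFunLike.congr_fun hcomp f
  have hsep : toContinuousMap.range.SeparatesPoints := by
    intro x y hxy
    obtain ⟨i, hi⟩ := Function.ne_iff.1 hxy
    exact ⟨_, ⟨toContinuousMap (MvPolynomial.X i), ⟨_, rfl⟩, rfl⟩, by simpa [happly] using hi⟩
  obtain ⟨_, ⟨f, rfl⟩, hf⟩ :=
    ContinuousMap.exists_mem_subalgebra_near_continuous_of_isCompact_of_separatesPoints hsep g hs hε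
  exact ⟨f, fun x hx => happly f x ▸ hf x hx⟩

theorem measure_ext_of_integral_eval_mvPolynomial [Finite σ] {ν₁ ν₂ : Measure (σ → ℝ)}
    [IsFiniteMeasure ν₁] [IsFiniteMeasure ν₂] (hs : IsCompact s) (h₁ : ∀ᵐ x ∂ν₁, x ∈ s)
    (h₂ : ∀ᵐ x ∂ν₂, x ∈ s)
    (h : ∀ f : MvPolynomial σ ℝ, ∫ x, f.eval x ∂ν₁ = ∫ x, f.eval x ∂ν₂) : ν₁ = ν₂ := by
  have := Fintype.ofFinite σ
  refine ext_of_forall_integral_eq_of_IsFiniteMeasure fun g => ?_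
  choose f hf using fun n : ℕ =>
    exists_mvPolynomial_near_of_isCompact hs g.toContinuousMap (Nat.one_div_pos_of_nat (n := n))
  have htendsto (ν : Measure (σ → ℝ)) [IsFiniteMeasure ν] (hν : ∀ᵐ x ∂ν, x ∈ s) :
      Filter.Tendsto (fun n => ∫ x, (f n).eval x ∂ν) Filter.atTop (nhds (∫ x, g x ∂ν)) := by
    refine tendsto_integral_of_dominated_convergence (fun _ => 1 + ‖g‖)
      (fun n => (f n).continuous_eval.aestronglyMeasurable) (integrable_const _)
      (fun n => hν.mono fun x hx => ?_) (hν.mono fun x hx => ?_)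
    · calc ‖(f n).eval x‖ ≤ ‖(f n).eval x - g x‖ + ‖g x‖ := norm_le_norm_sub_add _ _
        _ ≤ 1 + ‖g‖ := add_le_add
          ((hf n x hx).le.trans (div_le_self zero_le_one (by simp))) (g.norm_coe_le_norm x)
    · exact tendsto_iff_norm_sub_tendsto_zero.2 <| squeeze_zero (fun n => norm_nonneg _)
        (fun n => (hf n x hx).le) tendsto_one_div_add_atTop_nhds_zero_nat
  exact tendsto_nhds_unique (htendsto ν₁ h₁) (by simpa only [h] using htendsto ν₂ h₂)

end MomentProblem

section Symmetrization

variable {N : ℕ}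

lemma cubeIntegral_rename {σ : Type*} [Fintype σ] (π : Equiv.Perm σ) (f : MvPolynomial σ ℝ) :
    cubeIntegral σ (MvPolynomial.rename π f) = cubeIntegral σ f := by
  induction f using MvPolynomial.induction_on' with
  | monomial s c =>
    rw [MvPolynomial.rename_monomial, cubeIntegral_monomial, cubeIntegral_monomial,
      ← Equiv.prod_comp π fun i => ((Finsupp.mapDomain π s i : ℝ) + 1)⁻¹]
    simp only [Finsupp.mapDomain_apply π.injective]
  | add p q hp hq => rw [map_add, map_add, map_add, hp, hq]

lemma legendreFunctional_rename (π : Equiv.Perm (Fin N)) (f : MvPolynomial (Fin N) ℝ) :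
    legendreFunctional N (MvPolynomial.rename π f) = legendreFunctional N f := by
  rw [legendreFunctional_apply, legendreFunctional_apply, ← cubeIntegral_rename π (f * _),
    map_mul (MvPolynomial.rename π), isSymmetric_vandermondeSq π]

/-- The average of a polynomial over all permutations of its variables. -/
def symmetrization (f : MvPolynomial (Fin N) ℝ) : MvPolynomial (Fin N) ℝ :=
  (N ! : ℝ)⁻¹ • ∑ π : Equiv.Perm (Fin N), MvPolynomial.rename π f

lemma isSymmetric_symmetrization (f : MvPolynomial (Fin N) ℝ) :
    (symmetrization f).IsSymmetric := by
  intro σ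
  rw [symmetrization, map_smul, map_sum]
  congr 1
  simp only [MvPolynomial.rename_rename]
  exact Fintype.sum_equiv (Equiv.mulLeft σ) _ _ fun π => rfl

lemma legendreFunctional_symmetrization (f : MvPolynomial (Fin N) ℝ) :
    legendreFunctional N (symmetrization f) = legendreFunctional N f := by
  have hN : (N ! : ℝ) ≠ 0 := by exact_mod_cast Nat.factorial_ne_zero N
  simp [symmetrization, legendreFunctional_rename, Fintype.card_perm, hN]

end Symmetrization

section JointDensity

open Matrix

variable {N : ℕ}

lemma det_eval_normalizedLegendre (x : Fin N → ℝ) :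
    (of fun j i : Fin N => (normalizedLegendre i).eval (x j)).det =
      (∏ i : Fin N, (normalizedLegendre i).leadingCoeff) * (vandermonde x).det := by
  have hmonic := isMonicOrthogonal_monicLegendre N
  rw [det_eval_matrixOfPolynomials_eq_det_vandermonde x _ hmonic.natDegree_eq hmonic.monic,
    ← det_mul_row]
  congr 1 with j i
  simp [monicLegendre, normalizedLegendre_ne_zero]

lemma determinantalDensity_legendreKernel_eq (x : Fin N → ℝ) :
    determinantalDensity N (legendreKernel N) x =
      (N ! : ℝ)⁻¹ * (∏ i : Fin N, (normalizedLegendre i).leadingCoeff) ^ 2 *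
        (vandermondeSq N ℝ).eval x := by
  have hgram : (of fun j k => legendreKernel N (x j) (x k)) =
      (of fun j i : Fin N => (normalizedLegendre i).eval (x j)) *
        (of fun j i : Fin N => (normalizedLegendre i).eval (x j))ᵀ := by
    ext j k
    simp [Matrix.mul_apply, legendreKernel_eq_sum]
  rw [determinantalDensity, hgram, det_mul, det_transpose, det_eval_normalizedLegendre,
    eval_vandermondeSq, Nat.sub_self, Nat.factorial_zero, Nat.cast_one]
  ring

lemma integral_eval_determinantalMeasure (f : MvPolynomial (Fin N) ℝ) :
    ∫ x, f.eval x ∂determinantalMeasure N N =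
      (N ! : ℝ)⁻¹ * (∏ i : Fin N, (normalizedLegendre i).leadingCoeff) ^ 2 *
        legendreFunctional N f := by
  rw [determinantalMeasure, integral_withDensity_eq_integral_toReal_smul
    (measurable_ofReal_determinantalDensity N N) (ae_of_all _ fun x => ENNReal.ofReal_lt_top),
    legendreFunctional_apply, cubeIntegral_apply, ← integral_const_mul]
  congr with x
  rw [ENNReal.toReal_ofReal (determinantalDensity_nonneg N x), smul_eq_mul, map_mul,
    determinantalDensity_legendreKernel_eq]
  ring

lemma integral_eval_determinantalMeasure_mul_legendreFunctional_one
    (f : MvPolynomial (Fin N) ℝ) :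
    (∫ x, f.eval x ∂determinantalMeasure N N) * legendreFunctional N 1 =
      legendreFunctional N f := by
  have := isProbabilityMeasure_determinantalMeasure N
  have hone := integral_eval_determinantalMeasure (1 : MvPolynomial (Fin N) ℝ)
  simp only [map_one, integral_const, probReal_univ, smul_eq_mul, mul_one] at hone
  rw [integral_eval_determinantalMeasure, mul_right_comm, ← hone, one_mul]

lemma legendreFunctional_one_ne_zero (N : ℕ) : legendreFunctional N 1 ≠ 0 := fun h =>
  one_ne_zero (eq_zero_of_legendreFunctional_mul_self_eq_zero (by rwa [mul_one]))

end JointDensity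

section EigenvalueLaw

open Matrix
open scoped ComplexOrder

lemma eigenvalues_le_one_of_posSemidef_one_sub {n 𝕜 : Type*} [Fintype n] [DecidableEq n] [RCLike 𝕜]
    {H : Matrix n n 𝕜} (hH : H.IsHermitian) (h : (1 - H).PosSemidef) (i : n) :
    hH.eigenvalues i ≤ 1 := by
  have hnonneg := h.re_dotProduct_nonneg (hH.eigenvectorBasis i)
  have hnorm : RCLike.re (star ⇑(hH.eigenvectorBasis i) ⬝ᵥ ⇑(hH.eigenvectorBasis i)) = 1 := by
    rw [dotProduct_comm, ← EuclideanSpace.inner_eq_star_dotProduct, inner_self_eq_norm_sq_to_K,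
      hH.eigenvectorBasis.orthonormal.1 i]
    simp
  rwa [sub_mulVec, one_mulVec, dotProduct_sub, map_sub, hnorm, ← hH.eigenvalues_eq,
    sub_nonneg] at hnonneg

variable {N : ℕ}

lemma eigenvalues_mem_Icc (U : Matrix.unitaryGroup (Fin 2 × Fin N) ℂ) :
    eigenvalues U ∈ Set.Icc (0 : Fin N → ℝ) 1 := by
  refine ⟨fun i => eigenvalues_conjTranspose_mul_self_nonneg (block U) i, fun i =>
    eigenvalues_le_one_of_posSemidef_one_sub _ ?_ i⟩
  rw [← conjTranspose_lowerBlock_mul_lowerBlock]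
  exact posSemidef_conjTranspose_mul_self _

lemma measurable_eigenvalues_comp_perm (π : Equiv.Perm (Fin N)) :
    Measurable fun (U : Matrix.unitaryGroup (Fin 2 × Fin N) ℂ) i => eigenvalues U (π i) :=
  measurable_pi_lambda _ fun i =>
    (measurable_pi_apply (π i)).comp continuous_eigenvalues_block.measurable

lemma ae_mem_Icc_eigenvalueLaw (μ : Measure (Matrix.unitaryGroup (Fin 2 × Fin N) ℂ)) :
    ∀ᵐ x ∂eigenvalueLaw μ, x ∈ Set.Icc (0 : Fin N → ℝ) 1 := by
  rw [eigenvalueLaw, ← Measure.sum_fintype]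
  refine Measure.ae_smul_measure ((Measure.ae_sum_iff' measurableSet_Icc).2 fun π => ?_) _
  refine (ae_map_iff (measurable_eigenvalues_comp_perm π).aemeasurable measurableSet_Icc).2
    (ae_of_all _ fun U => ?_)
  exact ⟨fun i => (eigenvalues_mem_Icc U).1 (π i), fun i => (eigenvalues_mem_Icc U).2 (π i)⟩

variable (μ : Measure (Matrix.unitaryGroup (Fin 2 × Fin N) ℂ)) [IsFiniteMeasure μ]

instance isFiniteMeasure_eigenvalueLaw : IsFiniteMeasure (eigenvalueLaw μ) :=
  Measure.smul_finite _ (by simp [Nat.factorial_ne_zero])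

lemma integral_eval_eigenvalueLaw (f : MvPolynomial (Fin N) ℝ) :
    ∫ x, f.eval x ∂eigenvalueLaw μ = eigenvalueFunctional μ (symmetrization f) := by
  have heval (π : Equiv.Perm (Fin N)) (U : Matrix.unitaryGroup (Fin 2 × Fin N) ℂ) :
      f.eval (fun i => eigenvalues U (π i)) =
        (MvPolynomial.rename π f).eval (eigenvalues U) := by
    rw [MvPolynomial.eval_rename]; rfl
  have hmeas (π : Equiv.Perm (Fin N)) := (measurable_eigenvalues_comp_perm π).aemeasurable (μ := μ)
  rw [eigenvalueLaw, integral_smul_measure, integral_finsetSum_measure fun π _ => ?integrable,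
    symmetrization, map_smul, map_sum]
  case integrable =>
    rw [integrable_map_measure f.continuous_eval.aestronglyMeasurable (hmeas π)]
    simpa only [Function.comp_def, heval] using integrable_eval_eigenvalues μ _
  simp only [integral_map (hmeas _) f.continuous_eval.aestronglyMeasurable, heval,
    eigenvalueFunctional_apply, ENNReal.toReal_inv, ENNReal.toReal_natCast]

end EigenvalueLaw

section Main

variable {N : ℕ} (μ : Measure (Matrix.unitaryGroup (Fin 2 × Fin N) ℂ)) [IsProbabilityMeasure μ]
  [μ.IsMulLeftInvariant]

theorem eigenvalueLaw_eq_determinantalMeasure : eigenvalueLaw μ = determinantalMeasure N N := by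
  have := isProbabilityMeasure_determinantalMeasure N
  refine measure_ext_of_integral_eval_mvPolynomial isCompact_Icc (ae_mem_Icc_eigenvalueLaw μ)
    ((withDensity_absolutelyContinuous _ _).ae_le (ae_restrict_mem measurableSet_Icc))
    fun f => mul_right_cancel₀ (legendreFunctional_one_ne_zero N) ?_
  calc (∫ x, f.eval x ∂eigenvalueLaw μ) * legendreFunctional N 1
      = eigenvalueFunctional μ (symmetrization f) * legendreFunctional N 1 := by
        rw [integral_eval_eigenvalueLaw]
    _ = eigenvalueFunctional μ 1 * legendreFunctional N (symmetrization f) :=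
        (satisfiesLoopEquations_eigenvalueFunctional μ).apply_mul_legendreFunctional_one
          (isSymmetric_symmetrization f)
    _ = legendreFunctional N f := by
        simp [eigenvalueFunctional_apply, legendreFunctional_symmetrization]
    _ = (∫ x, f.eval x ∂determinantalMeasure N N) * legendreFunctional N 1 :=
        (integral_eval_determinantalMeasure_mul_legendreFunctional_one f).symm

theorem eigenvalueMarginal_eq_determinantalMeasure {ℓ : ℕ} (hℓ : ℓ ≤ N) :
    eigenvalueMarginal μ hℓ = determinantalMeasure N ℓ := by
  rw [eigenvalueMarginal, eigenvalueLaw_eq_determinantalMeasure, map_castLE_determinantalMeasure]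

end Main

end BlockEncoding

end

theorem mainTheorem11 (N : ℕ)
    (μ : MeasureTheory.Measure (Matrix.unitaryGroup (Fin 2 × Fin N) ℂ))
    [μ.IsHaarMeasure] [MeasureTheory.IsProbabilityMeasure μ] :
    (∀ x : ℝ, BlockEncoding.weight N 2 x = 1) ∧
    (∃ C : Fin N → Polynomial ℝ,
      BlockEncoding.IsMonicOrthogonal (BlockEncoding.weight N 2) C) ∧
    (∀ C : Fin N → Polynomial ℝ,
      BlockEncoding.IsMonicOrthogonal (BlockEncoding.weight N 2) C →
        ∀ x y : ℝ, BlockEncoding.kernel (BlockEncoding.weight N 2) C x y =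
          BlockEncoding.legendreKernel N x y) ∧
    (∀ (ℓ : ℕ) (hℓ : ℓ ≤ N),
      (∀ x : Fin ℓ → ℝ, 0 ≤
        BlockEncoding.determinantalDensity N (BlockEncoding.legendreKernel N) x) ∧
      BlockEncoding.eigenvalueMarginal μ hℓ =
        (MeasureTheory.volume.restrict (Set.Icc (0 : Fin ℓ → ℝ) 1)).withDensity (fun x =>
          ENNReal.ofReal
            (BlockEncoding.determinantalDensity N (BlockEncoding.legendreKernel N) x))) := by
  exact ⟨BlockEncoding.weight_two N, ⟨_, BlockEncoding.isMonicOrthogonal_monicLegendre N⟩,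
    fun _ hC => BlockEncoding.kernel_eq_legendreKernel hC,
    fun _ hℓ => ⟨BlockEncoding.determinantalDensity_nonneg N,
      BlockEncoding.eigenvalueMarginal_eq_determinantalMeasure μ hℓ⟩⟩
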